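/- **Prefix filter.** Let $n,k,m,s\ge 1$ be integers and $0<\alpha\le 1$ with $m=\frac{n}{\alpha k}$. Every key $x$ of a universe $\mathcal U$ has a fingerprint $\mathrm{FP}(x)=(\mathrm{bin}(x),\mathrm{fp}(x))\in[m]\times[s]$, where $\mathrm{FP}$ is a random function (its values are independent and uniform). The *prefix filter* has $m$ bins, each stored in one cache line. A bin holds at most $k$ mini-fingerprints (elements of $[s]$, with repetitions) and an overflow mark. There is also a *spare*: an incremental filter for the universe $[m]\times[s]$ with its own independent randomness, created for at most $n'=1.1\,\frac{n}{\sqrt{2\pi k}}$ insertions (repetitions allowed, since distinct keys may share a fingerprint) and false positive rate $\varepsilon'$; it is a deterministic function of its randomness and of $S(n',\varepsilon')$ bits of memory, and it works correctly for every sequence of at most $n'$ insertions. * *Insert $x$*: if $\mathrm{bin}(x)$ holds fewer than $k$ elements, add $\mathrm{fp}(x)$ to it. Otherwise let $M$ be the maximum of the bin. If $\mathrm{fp}(x)>M$, insert $\mathrm{FP}(x)$ into the spare; if not, replace $M$ by $\mathrm{fp}(x)$ in the bin and insert $(\mathrm{bin}(x),M)$ into the spare. In both cases mark the bin as overflowed.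 * *Query $x$*: if $\mathrm{bin}(x)$ is marked as overflowed and $\mathrm{fp}(x)$ exceeds the maximum of the bin, return the spare's answer to the query $\mathrm{FP}(x)$. Otherwise answer "Yes" iff $\mathrm{fp}(x)$ is in the bin. The filter *fails* when an insertion has to be forwarded to the spare after the spare has already received $\lfloor n'\rfloor$ insertions. Let $$\beta=\frac{2\pi k}{(0.1)^2\cdot 0.99\, n}=\frac{200\pi k}{0.99\,n}.$$ Fix a sequence $\sigma$ of queries and at most $n$ insertions of distinct keys, independently of the randomness. Then: 1. For every key $y$ not inserted in $\sigma$, the probability that the filter does not fail during $\sigma$ and that it answers "Yes" to the query $y$ issued after $\sigma$ is at most $\frac{\alpha k}{s}+\frac{1}{\sqrt{2\pi k}}\,\varepsilon'$. 2. The filter does not fail during $\sigma$ with probability at least $1-\beta$. 3. For every key $y$ (inserted in $\sigma$ or not), the query $y$ issued after $\sigma$ accesses a single cache line, namely its bin and not the spare, with probability at least $1-\frac{1}{\sqrt{2\pi k}}$; this probability is not conditioned on the absence of failure (the bins are updated in the same way after a failure). With probability at least $1-\beta$, the fraction of the insertions of $\sigma$ that access the spare is at most $\frac{1.1}{\sqrt{2\pi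 k}}$. 4. Suppose $s=k\cdot 2^R$ with an integer $R\ge 0$, and let each bin be stored as a pocket dictionary. This consists of a header, which gives the number of elements with quotient $q$ in unary for each $q=0,\dots,k-1$ (where $e=q2^R+r$ has quotient $q$ and remainder $r$, $0\le r<2^R$), followed by the $R$-bit remainders in increasing order of the elements, padded to the length of a full bin; in a full bin the last bit of the header, which is always a separator, serves as overflow mark. Then the bins together with the spare take exactly $\frac1\alpha\, n\,(\log_2(s/k)+2)+S(n',\varepsilon')$ bits, and these bits determine the state of the filter. -/

import Mathlib

open MeasureTheory ProbabilityTheory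

namespace PrefixFilter

/-! ### Incremental filters (used as the spare) -/

/-- An implementation of an incremental filter over the universe `V`, created for datasets of size
at most `N`, with false positive rate at most `ε`, whose whole state is `b` bits of memory and whose
random choices (hash functions) are a point `θ` of the probability space `(Θ, ν)`.
Since distinct keys may have equal fingerprints, the filter has to cope with sequences of at most
`N` insertions that contain repetitions. -/
structure IncrementalFilter (V : Type*) (N : ℕ) (ε : ℝ) (b : ℕ) {Θ : Type*} [MeasurableSpace Θ]
    (ν : Measure Θ) where
  /-- the empty filter -/
  init : Θ → (Fin b → Bool)
  /-- insertion -/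
  insert : Θ → (Fin b → Bool) → V → (Fin b → Bool)
  /-- membership query -/
  query : Θ → (Fin b → Bool) → V → Bool
  /-- inserted elements are always recognised -/
  no_false_negative : ∀ (θ : Θ) (L : List V), L.length ≤ N → ∀ v ∈ L,
    query θ (L.foldl (insert θ) (init θ)) v = true
  measurableSet_yes : ∀ (L : List V), L.length ≤ N → ∀ v,
    MeasurableSet {θ | query θ (L.foldl (insert θ) (init θ)) v = true}
  /-- every element that was not inserted is accepted with probability at most `ε` -/
  false_positive : ∀ (L : List V), L.length ≤ N → ∀ v, v ∉ L →
    ν.real {θ | query θ (L.foldl (insert θ) (init θ)) v = true} ≤ ε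

/-! ### State and operations of the prefix filter -/

/-- A bin of the bin table: the multiset of stored mini-fingerprints and the overflow mark. -/
@[ext]
structure Bin (s : ℕ) where
  fps : Multiset (Fin s)
  overflowed : Bool

/-- The state: `m` bins with elements in `[s]`, and the `b` bits of the spare. -/
@[ext]
structure State (m s b : ℕ) where
  bins : Fin m → Bin s
  spare : Fin b → Bool

/-- The places that an operation may access: a bin, which is a single cache line, or the spare. -/
inductive Loc (m : ℕ) where
  | bin (i : Fin m)
  | spare
  deriving DecidableEq

/-- Operations on a filter with keys in `U`. -/
inductive Op (U : Type*) where
  | insert (x : U)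
  | query (x : U)

/-- The key inserted by an operation, if any. -/
def Op.inserted? {U : Type*} : Op U → Option U
  | .insert x => some x
  | .query _ => none

/-- The list of keys inserted by a sequence of operations. -/
def insertedKeys {U : Type*} (σ : List (Op U)) : List U := σ.filterMap Op.inserted?

/-- A sequence of queries and at most `n` insertions of distinct keys. -/
def Admissible {U : Type*} (n : ℕ) (σ : List (Op U)) : Prop :=
  (insertedKeys σ).Nodup ∧ (insertedKeys σ).length ≤ n

section Operations

variable {m s N b : ℕ} [NeZero s] {ε : ℝ} {Θ : Type*} [MeasurableSpace Θ] {ν : Measure Θ}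

/-- The empty prefix filter. -/
def initState (F : IncrementalFilter (Fin m × Fin s) N ε b ν) (θ : Θ) : State m s b where
  bins := fun _ => ⟨0, false⟩
  spare := F.init θ

/-- Insertion of a key with fingerprint `v = (bin, mini-fingerprint)`, with bin capacity `k`:
the new state and the list of accessed locations. `B.fps.sup` is the maximum of the bin. -/
noncomputable def insertFP (k : ℕ) (F : IncrementalFilter (Fin m × Fin s) N ε b ν) (θ : Θ)
    (st : State m s b) (v : Fin m × Fin s) : State m s b × List (Loc m) :=
  let B := st.bins v.1
  let M := B.fps.sup
  if B.fps.card < k then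
    (⟨Function.update st.bins v.1 ⟨v.2 ::ₘ B.fps, B.overflowed⟩, st.spare⟩, [Loc.bin v.1])
  else if M < v.2 then
    (⟨Function.update st.bins v.1 ⟨B.fps, true⟩, F.insert θ st.spare v⟩,
      [Loc.bin v.1, Loc.spare])
  else
    (⟨Function.update st.bins v.1 ⟨v.2 ::ₘ B.fps.erase M, true⟩, F.insert θ st.spare (v.1, M)⟩,
      [Loc.bin v.1, Loc.spare])

/-- Query for a key with fingerprint `v = (bin, mini-fingerprint)`: the answer (`true` is "Yes") and
the list of accessed locations. -/
noncomputable def queryFP (F : IncrementalFilter (Fin m × Fin s) N ε b ν) (θ : Θ)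
    (st : State m s b) (v : Fin m × Fin s) : Bool × List (Loc m) :=
  let B := st.bins v.1
  if B.overflowed = true ∧ B.fps.sup < v.2 then
    (F.query θ st.spare v, [Loc.bin v.1, Loc.spare])
  else
    (decide (v.2 ∈ B.fps), [Loc.bin v.1])

/-- One operation, with fingerprint function `h`. The second component counts the insertions that
have accessed the spare so far. A query does not change the state. -/
noncomputable def step {U : Type*} (k : ℕ) (F : IncrementalFilter (Fin m × Fin s) N ε b ν) (θ : Θ)
    (h : U → Fin m × Fin s) (c : State m s b × ℕ) : Op U → State m s b × ℕ
  | .insert x =>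
      ((insertFP k F θ c.1 (h x)).1,
        if Loc.spare ∈ (insertFP k F θ c.1 (h x)).2 then c.2 + 1 else c.2)
  | .query _ => c

/-- Execution of a sequence of operations from the empty filter: the final state, and the number of
insertions that accessed the spare. -/
noncomputable def run {U : Type*} (k : ℕ) (F : IncrementalFilter (Fin m × Fin s) N ε b ν) (θ : Θ)
    (h : U → Fin m × Fin s) (σ : List (Op U)) : State m s b × ℕ :=
  σ.foldl (step k F θ h) (initState F θ, 0)

/-- The filter has failed during `σ`: some insertion had to be forwarded to the spare when the
spare, created for `N` elements, had already received `N` elements. -/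
def Failed {U : Type*} (k : ℕ) (F : IncrementalFilter (Fin m × Fin s) N ε b ν) (θ : Θ)
    (h : U → Fin m × Fin s) (σ : List (Op U)) : Prop :=
  N < (run k F θ h σ).2

/-- The states that some execution, with some hash function `h` and some randomness of the spare,
leads to. -/
def reachableStates (U : Type*) (k : ℕ) (F : IncrementalFilter (Fin m × Fin s) N ε b ν) :
    Set (State m s b) :=
  {st | ∃ (θ : Θ) (h : U → Fin m × Fin s) (σ : List (Op U)), st = (run k F θ h σ).1}

end Operations

/-! ### Memory layout -/

/-- Header of a pocket dictionary: the element `e` has quotient `e / 2 ^ R`; the numbers of elements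
with quotient `0, …, Q - 1` are written in unary with the symbol `false`, each one closed by the
separator `true`. -/
def pdHeader {s : ℕ} (Q R : ℕ) (M : Multiset (Fin s)) : List Bool :=
  (List.range Q).flatMap fun q =>
    List.replicate (M.countP fun e => e.val / 2 ^ R = q) false ++ [true]

/-- Body of a pocket dictionary: the `R`-bit remainders, in the order of the elements. -/
def pdBody {s : ℕ} (R : ℕ) (M : Multiset (Fin s)) : List Bool :=
  (M.sort (· ≤ ·)).flatMap fun e => List.ofFn fun i : Fin R => (e.val % 2 ^ R).testBit i

/-- The memory of a bin of capacity `k`: a pocket dictionary with `k` quotients and `R`-bit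
remainders, padded with zeros to the size of a full one. The last bit of a full header is always a
separator, so it carries no information; it is cleared to mark a (necessarily full) overflowed
bin. -/
def binMemory {s : ℕ} (k R : ℕ) (B : Bin s) : List Bool :=
  let header := if B.overflowed then (pdHeader k R B.fps).dropLast ++ [false]
    else pdHeader k R B.fps
  let w := header ++ pdBody R B.fps
  w ++ List.replicate (k * (R + 2) - w.length) false

/-- The memory of the prefix filter: its bins, followed by the spare. -/
def memory {m s b : ℕ} (k R : ℕ) (st : State m s b) : List Bool :=
  (List.ofFn st.bins).flatMap (binMemory k R) ++ List.ofFn st.spare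

/-! ### Randomness and parameters -/

/-- `FP` is a random function from `U` to `[m] × [s]`: its values are independent and uniform. -/
structure IsRandomFunction {U Ω : Type*} [MeasurableSpace Ω] {m s : ℕ}
    (FP : U → Ω → Fin m × Fin s) (μ : Measure Ω) : Prop where
  measurable : ∀ x, Measurable (FP x)
  indep : iIndepFun FP μ
  uniform : ∀ x v, μ.real {ω | FP x ω = v} = 1 / ((m : ℝ) * s)

/-- The dataset size `n' = 1.1 · n / √(2πk)` that the spare is created with. -/
noncomputable def spareSize (n k : ℕ) : ℝ := 1.1 * (n / √(2 * Real.pi * k))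

/-- The failure bound `2πk / (δ² · 0.99 · n)` with `δ = 0.1`. -/
noncomputable def failureBound (n k : ℕ) : ℝ := 2 * Real.pi * k / (0.1 ^ 2 * 0.99 * n)

end PrefixFilter

/-! The bins never read the spare, so the bins and the list of forwarded fingerprints depend on the
fingerprints alone (`run_eq_model`). What remains is a balls-in-bins problem: a bin that receives
`c` keys forwards `c - k` of them, and a query reaches the spare only if its bin has overflowed and
stores `k` smaller elements, which makes the queried key `Displaced`.

At most `c - k` keys of a bin with `c` keys are displaced, and keys are exchangeable. Hence a fixed
key is displaced with probability at most `E[(C - k) / C; C ≥ j]`, where `C - 1` is binomial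
(`expect_displaced_le`). Here `j = k + 1` for an inserted key and `j = k + 2` for an extra key,
which does not itself contribute to the overflow. The integrand increases with `C`, so the success
probability may be raised to `p = k / n` and the number of keys to its maximum. For an inserted key
the expectation is then exactly `(1 - p) * P(Bin(n, p) = k)` (`binomExp_excess_mean`), and Stirling
bounds this by `√(1 - p) / √(2πk)`. For an extra key there is an additional tail probability, which
the gain from the factor `√(1 - p)` absorbs (`binomExp_excess_succ_le`).

A false positive requires that the key shares its fingerprint with an inserted one (union bound), or
that it is displaced and the spare errs on an element it has not received. The randomness of the
spare is independent of the fingerprints, so the two probabilities in the second case multiply.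

The number of forwarded keys is the total excess. Its mean comes from the same estimate. A key
changes it by at most one, and only if its bin holds `k` others, so Efron–Stein and Markov bound the
variance and Chebyshev gives the concentration.

For the memory, the separators in the first `2 * k` bits reveal the overflow mark, the unary header
is a prefix code for the quotient counts, and sorting makes quotients and remainders match up. -/

namespace PrefixFilter

/-! ### The deterministic process on fingerprints -/

section Model

variable {m s : ℕ} [NeZero s]

/-- Insertion of a fingerprint, where the spare is replaced by the list of the fingerprints that it
has received. -/
noncomputable def insertModel (k : ℕ) (c : (Fin m → Bin s) × List (Fin m × Fin s))
    (v : Fin m × Fin s) : (Fin m → Bin s) × List (Fin m × Fin s) :=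
  let B := c.1 v.1
  if B.fps.card < k then
    (Function.update c.1 v.1 ⟨v.2 ::ₘ B.fps, B.overflowed⟩, c.2)
  else if B.fps.sup < v.2 then
    (Function.update c.1 v.1 ⟨B.fps, true⟩, c.2 ++ [v])
  else
    (Function.update c.1 v.1 ⟨v.2 ::ₘ B.fps.erase B.fps.sup, true⟩, c.2 ++ [(v.1, B.fps.sup)])

/-- The bins and the list of forwarded fingerprints after a list of insertions. -/
noncomputable def model (k : ℕ) (vs : List (Fin m × Fin s)) :
    (Fin m → Bin s) × List (Fin m × Fin s) :=
  vs.foldl (insertModel k) (fun _ => ⟨0, false⟩, [])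

theorem model_append_singleton (k : ℕ) (vs : List (Fin m × Fin s)) (v : Fin m × Fin s) :
    model k (vs ++ [v]) = insertModel k (model k vs) v := by
  simp [model]

/-- No decision depends on the contents of the spare, so the list it receives is independent of `θ`.
This holds after a failure as well. -/
theorem run_eq_model {N b : ℕ} {ε : ℝ} {Θ : Type*} [MeasurableSpace Θ] {ν : Measure Θ}
    {U : Type*} (k : ℕ) (F : IncrementalFilter (Fin m × Fin s) N ε b ν) (θ : Θ)
    (h : U → Fin m × Fin s) (σ : List (Op U)) :
    run k F θ h σ = (⟨(model k ((insertedKeys σ).map h)).1,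
      (model k ((insertedKeys σ).map h)).2.foldl (F.insert θ) (F.init θ)⟩,
      (model k ((insertedKeys σ).map h)).2.length) := by
  induction σ using List.reverseRecOn with
  | nil => simp [run, model, insertedKeys, initState]
  | append_singleton σ o ih =>
    have hrun : run k F θ h (σ ++ [o]) = step k F θ h (run k F θ h σ) o := by
      simp [run]
    rw [hrun, ih]
    cases o with
    | query x =>
      have hk : insertedKeys (σ ++ [Op.query x]) = insertedKeys σ := by
        rw [insertedKeys, List.filterMap_append]; simp [insertedKeys, List.filterMap, Op.inserted?]
      rw [hk]; rfl
    | insert x =>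
      have hk : insertedKeys (σ ++ [Op.insert x]) = insertedKeys σ ++ [x] := by
        simp [insertedKeys, Op.inserted?]
      rw [hk, List.map_append, List.map_singleton, model_append_singleton]
      generalize model k ((insertedKeys σ).map h) = c
      simp only [step, insertFP, insertModel]
      split_ifs <;> simp_all

theorem sup_mem {M : Multiset (Fin s)} (hM : M ≠ 0) : M.sup ∈ M := by
  induction M using Multiset.induction with
  | empty => exact absurd rfl hM
  | cons a M ih =>
    rw [Multiset.sup_cons]
    by_cases h0 : M = 0
    · subst h0; simp
    · rcases le_total a M.sup with h | h
      · rw [sup_eq_right.2 h]; exact Multiset.mem_cons_of_mem (ih h0)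
      · rw [sup_eq_left.2 h]; exact Multiset.mem_cons_self _ _

/-- What is known about the bins and the forwarded fingerprints after the insertion of `vs`. -/
structure ModelInv (k : ℕ) (vs : List (Fin m × Fin s))
    (c : (Fin m → Bin s) × List (Fin m × Fin s)) : Prop where
  map_le : ∀ b, (c.1 b).fps.map (Prod.mk b) ≤ (vs : Multiset (Fin m × Fin s))
  mem_of_forwarded : ∀ v ∈ c.2, v ∈ vs
  card : ∀ b, (c.1 b).fps.card = min k (vs.countP fun v => v.1 = b)
  overflowed : ∀ b, (c.1 b).overflowed = true ↔ k < vs.countP fun v => v.1 = b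
  forwarded : ∀ b, c.2.countP (fun v => v.1 = b) = vs.countP (fun v => v.1 = b) - k

/-- An insertion into a bin that is not full adds one element; an insertion into a full bin keeps
the size and forwards exactly one. That a bin holds its `k` smallest elements is never needed: size
and containment suffice. -/
theorem model_inv {k : ℕ} (hk : 1 ≤ k) (vs : List (Fin m × Fin s)) :
    ModelInv k vs (model k vs) := by
  induction vs using List.reverseRecOn with
  | nil => constructor <;> simp [model]
  | append_singleton vs v ih =>
    rw [model_append_singleton]
    generalize model k vs = c at ih
    obtain ⟨h1, h2, h3, h4, h5⟩ := ih
    have hcoe : ((vs ++ [v] : List _) : Multiset (Fin m × Fin s)) = v ::ₘ (vs : Multiset _) := by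
      rw [← Multiset.coe_add, Multiset.add_comm]; rfl
    have hle : (vs : Multiset (Fin m × Fin s)) ≤ ((vs ++ [v] : List _) : Multiset _) := by
      rw [hcoe]; exact Multiset.le_cons_self _ _
    unfold insertModel
    by_cases hc : (c.1 v.1).fps.card < k
    · simp only [hc, if_true]
      have hlt : vs.countP (fun w => w.1 = v.1) < k := by
        have := h3 v.1; omega
      constructor
      · intro b
        by_cases hb : b = v.1
        · subst hb
          simp only [Function.update_self, Multiset.map_cons]
          rw [hcoe]; exact Multiset.cons_le_cons _ (h1 _)
        · simp only [Function.update_of_ne hb]; exact (h1 b).trans hle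
      · intro w hw; exact List.mem_append_left _ (h2 w hw)
      all_goals
        intro b
        have h3b := h3 b; have h4b := h4 b; have h5b := h5 b
        by_cases hb : b = v.1
        · subst hb
          simp [List.countP_append, *]; omega
        · simp [List.countP_append, Ne.symm hb, *]
    · have hge : k ≤ vs.countP (fun w => w.1 = v.1) := by
        have := h3 v.1; omega
      have hcard : (c.1 v.1).fps.card = k := by
        have := h3 v.1; omega
      -- A full bin is nonempty because `1 ≤ k`; otherwise `sup` would be the default bottom element
      -- and not a stored one.
      have hne : (c.1 v.1).fps ≠ 0 := by
        intro h0; rw [h0] at hcard; simp at hcard; omega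
      have hmem := sup_mem hne
      by_cases hs : (c.1 v.1).fps.sup < v.2
      · simp only [hc, hs, if_true, if_false]
        constructor
        · intro b
          by_cases hb : b = v.1
          · subst hb
            simp only [Function.update_self]
            exact (h1 _).trans hle
          · simp only [Function.update_of_ne hb]; exact (h1 b).trans hle
        · intro w hw
          rcases List.mem_append.1 hw with hw | hw
          · exact List.mem_append_left _ (h2 w hw)
          · exact List.mem_append_right _ hw
        all_goals
          intro b
          have h3b := h3 b; have h4b := h4 b; have h5b := h5 b
          by_cases hb : b = v.1
          · subst hb
            simp [List.countP_append, hcard, h5b]; omega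
          · simp [List.countP_append, Function.update_of_ne hb, Ne.symm hb,
              h3b, h4b, h5b]
      · simp only [hc, hs, if_false]
        constructor
        · intro b
          by_cases hb : b = v.1
          · subst hb
            simp only [Function.update_self, Multiset.map_cons]
            rw [hcoe]
            exact Multiset.cons_le_cons _
              ((Multiset.map_le_map (Multiset.erase_le _ _)).trans (h1 _))
          · simp only [Function.update_of_ne hb]; exact (h1 b).trans hle
        · intro w hw
          rcases List.mem_append.1 hw with hw | hw
          · exact List.mem_append_left _ (h2 w hw)
          · rw [List.mem_singleton.1 hw]
            -- The evicted maximum is a stored element, hence the fingerprint of an earlier key.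
            refine List.mem_append_left _ ?_
            exact Multiset.mem_coe.1 (Multiset.mem_of_le (h1 v.1) (Multiset.mem_map_of_mem _ hmem))
        all_goals
          intro b
          have h3b := h3 b; have h4b := h4 b; have h5b := h5 b
          by_cases hb : b = v.1
          · subst hb
            simp [List.countP_append, hcard, h5b,
              Multiset.card_erase_of_mem hmem]; omega
          · simp [List.countP_append, Function.update_of_ne hb, Ne.symm hb,
              h3b, h4b, h5b]

theorem length_forwarded {k : ℕ} (hk : 1 ≤ k) (vs : List (Fin m × Fin s)) :
    (model k vs).2.length = ∑ b, (vs.countP (fun v => v.1 = b) - k) := by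
  rw [← Finset.sum_congr rfl fun b _ => (model_inv hk vs).forwarded b]
  generalize (model k vs).2 = l
  induction l with
  | nil => simp
  | cons a l ih => simp [List.countP_cons, Finset.sum_add_distrib, ih]

/-- If a query reaches the spare, its bin has received more than `k` elements, at least `k` of which
are smaller than the queried one. -/
theorem le_countP_of_forwarded {k : ℕ} (hk : 1 ≤ k) (vs : List (Fin m × Fin s))
    (v : Fin m × Fin s) (ho : ((model k vs).1 v.1).overflowed = true)
    (hs : ((model k vs).1 v.1).fps.sup < v.2) :
    k < vs.countP (fun w => w.1 = v.1) ∧ k ≤ vs.countP (fun w => w.1 = v.1 ∧ w.2 < v.2) := by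
  have hI := model_inv hk vs
  have h1 := (hI.overflowed _).1 ho
  refine ⟨h1, ?_⟩
  have h2 := hI.card v.1
  rw [min_eq_left h1.le] at h2
  have h3 := Multiset.countP_le_of_le (fun w : Fin m × Fin s => w.1 = v.1 ∧ w.2 < v.2)
    (hI.map_le v.1)
  rw [Multiset.countP_map, Multiset.coe_countP] at h3
  refine le_trans ?_ h3
  rw [Multiset.filter_eq_self.2, h2]
  intro a ha
  exact ⟨rfl, (Multiset.le_sup ha).trans_lt hs⟩

theorem mem_of_mem_bin {k : ℕ} (hk : 1 ≤ k) (vs : List (Fin m × Fin s)) (v : Fin m × Fin s)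
    (hv : v.2 ∈ ((model k vs).1 v.1).fps) : v ∈ vs :=
  Multiset.mem_coe.1 (Multiset.mem_of_le ((model_inv hk vs).map_le v.1)
    (Multiset.mem_map.2 ⟨v.2, hv, rfl⟩))

end Model

/-! ### Size and unique decodability of the memory layout -/

section Memory

/-- A list of numbers, written in unary with separators, is a prefix code. -/
theorem unary_append_inj {qs : List ℕ} {c c' : ℕ → ℕ} {w w' : List Bool}
    (h : (qs.flatMap fun q => List.replicate (c q) false ++ [true]) ++ w =
      (qs.flatMap fun q => List.replicate (c' q) false ++ [true]) ++ w') :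
    (∀ q ∈ qs, c q = c' q) ∧ w = w' := by
  induction qs with
  | nil => simpa using h
  | cons q qs ih =>
    have key : ∀ (a a' : ℕ) (u u' : List Bool), List.replicate a false ++ true :: u =
        List.replicate a' false ++ true :: u' → a = a' ∧ u = u' := by
      intro a
      induction a with
      | zero =>
        intro a' u u' h
        cases a' with
        | zero => simpa using h
        | succ a' => simp [List.replicate_succ] at h
      | succ a iha =>
        intro a' u u' h
        cases a' with
        | zero => simp [List.replicate_succ] at h
        | succ a' =>
          simp only [List.replicate_succ, List.cons_append, List.cons.injEq, true_and] at h
          have := iha _ _ _ h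
          exact ⟨by omega, this.2⟩
    simp only [List.flatMap_cons, List.append_assoc, List.singleton_append] at h
    obtain ⟨h1, h2⟩ := key _ _ _ _ h
    obtain ⟨h3, h4⟩ := ih h2
    exact ⟨by simpa [h1] using h3, h4⟩

/-- Blocks of equal length can be cut apart without separators. This serves both for the remainders
within a bin and for the bins within the memory. -/
theorem flatMap_inj_of_length_eq {α β : Type*} {f : α → List β} {L : ℕ} (P : α → Prop)
    (hlen : ∀ a, P a → (f a).length = L) (hinj : ∀ a b, P a → P b → f a = f b → a = b) :
    ∀ {l l' : List α} {w w' : List β}, l.length = l'.length → (∀ a ∈ l, P a) → (∀ a ∈ l', P a) →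
      l.flatMap f ++ w = l'.flatMap f ++ w' → l = l' ∧ w = w' := by
  intro l
  induction l with
  | nil =>
    intro l' w w' hl _ _ h
    have : l' = [] := List.length_eq_zero_iff.1 hl.symm
    subst this
    simpa using h
  | cons a l ih =>
    intro l' w w' hl h1 h2 h
    cases l' with
    | nil => simp at hl
    | cons b l' =>
      simp only [List.flatMap_cons, List.append_assoc] at h
      have ha := h1 a (by simp)
      have hb := h2 b (by simp)
      obtain ⟨h3, h4⟩ := List.append_inj h (by rw [hlen a ha, hlen b hb])
      obtain ⟨h5, h6⟩ := ih (by simpa using hl) (fun x hx => h1 x (by simp [hx]))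
        (fun x hx => h2 x (by simp [hx])) h4
      exact ⟨by rw [hinj a b ha hb h3, h5], h6⟩

variable {s k R : ℕ}

theorem quotient_lt (hs : s = k * 2 ^ R) (e : Fin s) : e.val / 2 ^ R < k :=
  Nat.div_lt_of_lt_mul (by rw [Nat.mul_comm, ← hs]; exact e.2)

theorem sum_countP_quotient (hs : s = k * 2 ^ R) (M : Multiset (Fin s)) :
    ∑ q ∈ Finset.range k, M.countP (fun e => e.val / 2 ^ R = q) = M.card := by
  induction M using Multiset.induction with
  | empty => simp
  | cons a M ih =>
    simp only [Multiset.countP_cons, Finset.sum_add_distrib, ih, Multiset.card_cons]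
    simp [quotient_lt hs a]

theorem length_pdHeader (hs : s = k * 2 ^ R) (M : Multiset (Fin s)) :
    (pdHeader k R M).length = M.card + k := by
  rw [← sum_countP_quotient hs M, pdHeader, List.length_flatMap]
  simp only [List.length_append, List.length_replicate, List.length_singleton]
  rw [← List.sum_toFinset _ List.nodup_range]
  simp [Finset.sum_add_distrib, List.toFinset_range]

theorem length_pdBody (M : Multiset (Fin s)) : (pdBody R M).length = R * M.card := by
  simp [pdBody, List.length_flatMap, Nat.mul_comm]

theorem count_true_pdHeader (M : Multiset (Fin s)) : (pdHeader k R M).count true = k := by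
  simp [pdHeader, List.count_flatMap, List.count_replicate, Function.comp_def]

theorem pdHeader_eq_dropLast_append (hk : 1 ≤ k) (M : Multiset (Fin s)) :
    pdHeader k R M = (pdHeader k R M).dropLast ++ [true] := by
  obtain ⟨k, rfl⟩ := Nat.exists_eq_succ_of_ne_zero (by omega : k ≠ 0)
  simp only [pdHeader, List.range_succ, List.flatMap_append, List.flatMap_singleton,
    ← List.append_assoc, List.dropLast_concat]

/-- The bins that occur during the operation of the filter. -/
def Bin.Valid (k : ℕ) (B : Bin s) : Prop :=
  B.fps.card ≤ k ∧ (B.overflowed = true → B.fps.card = k)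

/-- The header of a pocket dictionary with its overflow mark. -/
def markedHeader (k R : ℕ) (B : Bin s) : List Bool :=
  if B.overflowed then (pdHeader k R B.fps).dropLast ++ [false] else pdHeader k R B.fps

theorem length_markedHeader (hk : 1 ≤ k) (hs : s = k * 2 ^ R) (B : Bin s) :
    (markedHeader k R B).length = B.fps.card + k := by
  unfold markedHeader
  split_ifs
  · simp [length_pdHeader hs]; omega
  · exact length_pdHeader hs _

theorem binMemory_eq (hk : 1 ≤ k) (hs : s = k * 2 ^ R) (B : Bin s) :
    binMemory k R B = markedHeader k R B ++ (pdBody R B.fps ++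
      List.replicate (k * (R + 2) - (B.fps.card + k + R * B.fps.card)) false) := by
  rw [← length_markedHeader hk hs B, ← length_pdBody, ← List.length_append, ← List.append_assoc]
  rfl

theorem length_binMemory (hk : 1 ≤ k) (hs : s = k * 2 ^ R) {B : Bin s} (hB : B.fps.card ≤ k) :
    (binMemory k R B).length = k * (R + 2) := by
  rw [binMemory_eq hk hs]
  simp only [List.length_append, length_markedHeader hk hs, length_pdBody, List.length_replicate]
  have : B.fps.card + k + R * B.fps.card ≤ k * (R + 2) := by nlinarith
  omega

theorem count_true_markedHeader (hk : 1 ≤ k) (B : Bin s) :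
    (markedHeader k R B).count true = if B.overflowed then k - 1 else k := by
  unfold markedHeader
  split_ifs
  · have h1 := count_true_pdHeader (k := k) (R := R) B.fps
    rw [pdHeader_eq_dropLast_append hk] at h1
    simp only [List.count_append, List.count_singleton_self] at h1
    simp; omega
  · exact count_true_pdHeader _

/-- The first `2 * k` bits show whether the bin has overflowed. -/
theorem count_true_take_binMemory (hk : 1 ≤ k) (hs : s = k * 2 ^ R) {B : Bin s}
    (hB : B.Valid k) :
    B.overflowed = true ↔ ((binMemory k R B).take (2 * k)).count true < k := by
  rw [binMemory_eq hk hs, List.take_append, List.count_append]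
  have hlen := length_markedHeader hk hs B
  -- The header has at most `2 * k` bits, so all its separators are counted: `k` of them, or `k - 1`
  -- if the last one was cleared.
  rw [List.take_of_length_le (by have := hB.1; omega), count_true_markedHeader hk]
  constructor
  · intro h
    have := hB.2 h
    -- An overflowed bin is full, so its header fills the `2 * k` bits and no body bit is counted.
    rw [hlen, this, if_pos h, show 2 * k - (k + k) = 0 by omega, List.take_zero, List.count_nil]
    omega
  · intro h
    by_contra h'
    rw [if_neg h'] at h
    omega

/-- Quotients are nondecreasing along the sorted elements, so their counts determine the list of
quotients. The body lists the remainders in the same order, and an element is recovered from its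
quotient and remainder. -/
theorem eq_of_map_quotient_of_flatMap_remainder (M M' : Multiset (Fin s)) {w w' : List Bool}
    (hq : ∀ q, M.countP (fun e => e.val / 2 ^ R = q) = M'.countP (fun e => e.val / 2 ^ R = q))
    (hcard : M.card = M'.card) (h : pdBody R M ++ w = pdBody R M' ++ w') : M = M' := by
  have hdiv : (M.sort (· ≤ ·)).map (fun e => e.val / 2 ^ R) =
      (M'.sort (· ≤ ·)).map (fun e => e.val / 2 ^ R) := by
    have hs : ∀ N : Multiset (Fin s),
        ((N.sort (· ≤ ·)).map (fun e => e.val / 2 ^ R)).Pairwise (· ≤ ·) := by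
      intro N
      rw [List.pairwise_map]
      exact (Multiset.pairwise_sort N (· ≤ ·)).imp fun hab => Nat.div_le_div_right hab
    refine List.Perm.eq_of_pairwise (fun a b _ _ h1 h2 => le_antisymm h1 h2) (hs M) (hs M') ?_
    rw [← Multiset.coe_eq_coe, ← Multiset.map_coe, ← Multiset.map_coe, Multiset.sort_eq,
      Multiset.sort_eq]
    ext q
    rw [Multiset.count_map, Multiset.count_map, ← Multiset.countP_eq_card_filter,
      ← Multiset.countP_eq_card_filter]
    simpa [eq_comm] using hq q
  have hmod : (M.sort (· ≤ ·)).map (fun e => e.val % 2 ^ R) =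
      (M'.sort (· ≤ ·)).map (fun e => e.val % 2 ^ R) := by
    refine (flatMap_inj_of_length_eq (f := fun r : ℕ => List.ofFn fun i : Fin R => r.testBit i)
      (L := R) (fun r => r < 2 ^ R) (by simp) ?_ (by simp [hcard]) ?_ ?_
      (w := w) (w' := w') ?_).1
    · intro a b ha hb hab
      have hab := List.ofFn_injective hab
      apply Nat.eq_of_testBit_eq
      intro i
      by_cases hi : i < R
      · exact congrFun hab ⟨i, hi⟩
      · have hle : 2 ^ R ≤ 2 ^ i := Nat.pow_le_pow_right (by norm_num) (by omega)
        rw [Nat.testBit_lt_two_pow (ha.trans_le hle), Nat.testBit_lt_two_pow (hb.trans_le hle)]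
    · intro a ha
      obtain ⟨e, _, rfl⟩ := List.mem_map.1 ha
      exact Nat.mod_lt _ (by positivity)
    · intro a ha
      obtain ⟨e, _, rfl⟩ := List.mem_map.1 ha
      exact Nat.mod_lt _ (by positivity)
    · simpa [pdBody, List.flatMap_map] using h
  rw [← Multiset.sort_eq M (· ≤ ·), ← Multiset.sort_eq M' (· ≤ ·)]
  congr 1
  have hl : (M.sort (· ≤ ·)).length = (M'.sort (· ≤ ·)).length := by simp [hcard]
  refine List.ext_getElem hl fun i h1 h2 => ?_
  have e1 := List.getElem_of_eq hdiv (i := i) (by simpa using h1)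
  have e2 := List.getElem_of_eq hmod (i := i) (by simpa using h1)
  simp only [List.getElem_map] at e1 e2
  apply Fin.ext
  rw [← Nat.div_add_mod (M.sort (· ≤ ·))[i].val (2 ^ R), e1, e2, Nat.div_add_mod]

/-- The overflow mark is read first; restoring the cleared separator then yields an ordinary header,
which can be decoded. -/
theorem binMemory_injOn (hk : 1 ≤ k) (hs : s = k * 2 ^ R) {B B' : Bin s} (hB : B.Valid k)
    (hB' : B'.Valid k) (h : binMemory k R B = binMemory k R B') : B = B' := by
  have ho : B.overflowed = B'.overflowed := by
    rw [Bool.eq_iff_iff, count_true_take_binMemory hk hs hB, count_true_take_binMemory hk hs hB', h]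
  have hw : ∃ w w', pdHeader k R B.fps ++ (pdBody R B.fps ++ w) =
      pdHeader k R B'.fps ++ (pdBody R B'.fps ++ w') := by
    rw [binMemory_eq hk hs, binMemory_eq hk hs] at h
    by_cases hb : B.overflowed = true
    · have hb' := hb
      rw [ho] at hb'
      obtain ⟨h1, h2⟩ := List.append_inj h (by
        rw [length_markedHeader hk hs, length_markedHeader hk hs, hB.2 hb, hB'.2 hb'])
      simp only [markedHeader, hb, hb', if_true] at h1
      have h3 : pdHeader k R B.fps = pdHeader k R B'.fps := by
        rw [pdHeader_eq_dropLast_append hk B.fps, pdHeader_eq_dropLast_append hk B'.fps,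
          List.append_cancel_right h1]
      exact ⟨_, _, congrArg₂ (· ++ ·) h3 h2⟩
    · have hb' := hb
      rw [ho] at hb'
      simp only [markedHeader, hb, hb'] at h
      exact ⟨_, _, h⟩
  obtain ⟨w, w', hw⟩ := hw
  obtain ⟨h1, h2⟩ := unary_append_inj hw
  have hcard : B.fps.card = B'.fps.card := by
    rw [← sum_countP_quotient hs, ← sum_countP_quotient hs B'.fps]
    exact Finset.sum_congr rfl fun q hq => h1 q (by simpa using hq)
  refine Bin.ext (eq_of_map_quotient_of_flatMap_remainder (R := R) _ _ (fun q => ?_) hcard h2) ho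
  by_cases hq : q < k
  · exact h1 q (by simpa using hq)
  · have : ∀ N : Multiset (Fin s), N.countP (fun e => e.val / 2 ^ R = q) = 0 := by
      intro N
      rw [Multiset.countP_eq_zero]
      intro e _ he
      exact hq (he ▸ quotient_lt hs e)
    rw [this, this]

theorem length_memory {m b : ℕ} (hk : 1 ≤ k) (hs : s = k * 2 ^ R) {st : State m s b}
    (hst : ∀ i, (st.bins i).Valid k) :
    (memory k R st).length = m * (k * (R + 2)) + b := by
  simp only [memory, List.length_append, List.length_flatMap, List.length_ofFn, List.map_ofFn]
  rw [List.sum_ofFn]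
  simp [length_binMemory hk hs (hst _).1]

theorem memory_inj {m b : ℕ} (hk : 1 ≤ k) (hs : s = k * 2 ^ R) {st st' : State m s b}
    (hst : ∀ i, (st.bins i).Valid k) (hst' : ∀ i, (st'.bins i).Valid k)
    (h : memory k R st = memory k R st') : st = st' := by
  obtain ⟨h1, h2⟩ := flatMap_inj_of_length_eq (L := k * (R + 2)) (fun B : Bin s => B.Valid k)
    (fun B hB => length_binMemory hk hs hB.1) (fun B B' hB hB' => binMemory_injOn hk hs hB hB')
    (by simp) (by simpa [List.mem_ofFn] using hst) (by simpa [List.mem_ofFn] using hst') h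
  exact State.ext (List.ofFn_injective h1) (List.ofFn_injective h2)

theorem valid_of_mem_reachableStates {U : Type*} {m N b : ℕ} [NeZero s] {ε : ℝ} {Θ : Type*}
    [MeasurableSpace Θ] {ν : Measure Θ} (hk : 1 ≤ k)
    {F : IncrementalFilter (Fin m × Fin s) N ε b ν} {st : State m s b}
    (hst : st ∈ reachableStates U k F) (i : Fin m) : (st.bins i).Valid k := by
  obtain ⟨θ, h, σ, rfl⟩ := hst
  rw [run_eq_model]
  have hI := model_inv hk ((insertedKeys σ).map h)
  constructor
  · rw [hI.card i]; exact min_le_left _ _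
  · intro ho
    rw [hI.card i]
    exact min_eq_left ((hI.overflowed i).1 ho).le

end Memory

/-! ### Binomial expectations, tails and the expected excess -/

section Binomial

/-- The expectation of `g X` for a binomial random variable `X` with `t` trials and success
probability `p`. -/
def binomExp (p : ℝ) : ℕ → (ℕ → ℝ) → ℝ
  | 0, g => g 0
  | t + 1, g => p * binomExp p t (fun x => g (x + 1)) + (1 - p) * binomExp p t g

variable {p q : ℝ} {t : ℕ} {g g' : ℕ → ℝ}

theorem binomExp_mono_fun (hp : 0 ≤ p) (hp1 : p ≤ 1) (h : ∀ x, g x ≤ g' x) :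
    binomExp p t g ≤ binomExp p t g' := by
  induction t generalizing g g' with
  | zero => exact h 0
  | succ t ih =>
    exact add_le_add (mul_le_mul_of_nonneg_left (ih fun x => h _) hp)
      (mul_le_mul_of_nonneg_left (ih h) (by linarith))

/-- Conditioning on the first trial, a larger `p` moves weight from `g` to its shift, which is
larger for monotone `g`. -/
theorem binomExp_mono_prob (hp : 0 ≤ p) (hpq : p ≤ q) (hq : q ≤ 1) (hg : Monotone g) :
    binomExp p t g ≤ binomExp q t g := by
  induction t generalizing g with
  | zero => exact le_rfl
  | succ t ih =>
    have hg' : Monotone fun x => g (x + 1) := fun a b h => hg (by omega)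
    have h1 := ih hg
    have h2 := ih hg'
    have h3 : binomExp p t g ≤ binomExp p t (fun x => g (x + 1)) :=
      binomExp_mono_fun hp (hpq.trans hq) fun x => hg (by omega)
    simp only [binomExp]
    nlinarith [mul_le_mul_of_nonneg_left h2 (hp.trans hpq),
      mul_le_mul_of_nonneg_left h1 (sub_nonneg.2 hq), mul_nonneg (sub_nonneg.2 hpq)
        (sub_nonneg.2 h3)]

theorem binomExp_mono_trials {t' : ℕ} (hp : 0 ≤ p) (hp1 : p ≤ 1) (hg : Monotone g) (h : t ≤ t') :
    binomExp p t g ≤ binomExp p t' g := by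
  induction t', h using Nat.le_induction with
  | base => exact le_rfl
  | succ t' _ ih =>
    refine ih.trans ?_
    have h3 : binomExp p t' g ≤ binomExp p t' (fun x => g (x + 1)) :=
      binomExp_mono_fun hp hp1 fun x => hg (by omega)
    simp only [binomExp]
    nlinarith [mul_le_mul_of_nonneg_left h3 hp]

theorem binomExp_id_add (a : ℝ) : binomExp p t (fun x => x + a) = t * p + a := by
  induction t generalizing a with
  | zero => simp [binomExp]
  | succ t ih =>
    simp only [binomExp, ih, Nat.cast_add, Nat.cast_one, add_assoc]
    ring

theorem binomExp_mul_left (c : ℝ) : binomExp p t (fun x => c * g x) = c * binomExp p t g := by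
  induction t generalizing g with
  | zero => rfl
  | succ t ih => simp only [binomExp, ih]; ring

theorem binomExp_add : binomExp p t (fun x => g x + g' x) =
    binomExp p t g + binomExp p t g' := by
  induction t generalizing g g' with
  | zero => rfl
  | succ t ih => simp only [binomExp, ih]; ring

theorem binomExp_const (c : ℝ) : binomExp p t (fun _ => c) = c := by
  induction t with
  | zero => rfl
  | succ t ih => simp only [binomExp, ih]; ring

/-- The binomial weights. -/
def binomWeight (p : ℝ) (t x : ℕ) : ℝ := t.choose x * p ^ x * (1 - p) ^ (t - x)

theorem binomWeight_succ_succ (x : ℕ) : binomWeight p (t + 1) (x + 1) =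
    p * binomWeight p t x + (1 - p) * binomWeight p t (x + 1) := by
  unfold binomWeight
  rw [Nat.choose_succ_succ]
  rcases lt_or_ge x t with h | h
  · obtain ⟨d, rfl⟩ := Nat.exists_eq_add_of_lt h
    rw [show x + d + 1 + 1 - (x + 1) = d + 1 by omega, show x + d + 1 - x = d + 1 by omega,
      show x + d + 1 - (x + 1) = d by omega]
    push_cast; ring
  · rw [Nat.choose_eq_zero_of_lt (show t < x + 1 by omega), show t + 1 - (x + 1) = t - x by omega]
    push_cast; ring

theorem binomWeight_succ_zero : binomWeight p (t + 1) 0 = (1 - p) * binomWeight p t 0 := by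
  simp [binomWeight, pow_succ]; ring

theorem binomWeight_eq_zero {x : ℕ} (h : t < x) : binomWeight p t x = 0 := by
  simp [binomWeight, Nat.choose_eq_zero_of_lt h]

theorem binomExp_eq_sum {T : ℕ} (hT : t < T) :
    binomExp p t g = ∑ x ∈ Finset.range T, binomWeight p t x * g x := by
  induction t generalizing g T with
  | zero =>
    rw [Finset.sum_eq_single 0]
    · simp [binomExp, binomWeight]
    · intro x _ hx; rw [binomWeight_eq_zero (by omega), zero_mul]
    · intro h; simp at h; omega
  | succ t ih =>
    obtain ⟨T, rfl⟩ := Nat.exists_eq_succ_of_ne_zero (by omega : T ≠ 0)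
    rw [binomExp, ih (T := T) (by omega), ih (T := T + 1) (by omega), Finset.sum_range_succ',
      Finset.sum_range_succ' (n := T), binomWeight_succ_zero, mul_add, Finset.mul_sum,
      Finset.mul_sum, ← add_assoc, ← Finset.sum_add_distrib]
    congr 1
    · refine Finset.sum_congr rfl fun x _ => ?_
      rw [binomWeight_succ_succ]; ring
    · ring

/-- Size biasing: weighting `t + 1` trials by the number of successes fixes one success and leaves
`t` trials. It removes the denominator of the excess. -/
theorem succ_mul_binomWeight_succ (x : ℕ) :
    ((x : ℝ) + 1) * binomWeight p (t + 1) (x + 1) = (t + 1) * p * binomWeight p t x := by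
  have h : ((t : ℝ) + 1) * t.choose x = (t + 1).choose (x + 1) * (x + 1) := by
    exact_mod_cast Nat.add_one_mul_choose_eq t x
  unfold binomWeight
  rw [show t + 1 - (x + 1) = t - x by omega]
  linear_combination (-p ^ (x + 1) * (1 - p) ^ (t - x)) * h

/-- The probability of at least `j` successes. -/
noncomputable def binomTail (p : ℝ) (t j : ℕ) : ℝ :=
  binomExp p t fun x => if j ≤ x then 1 else 0

theorem binomTail_succ_right (j : ℕ) :
    binomTail p t j = binomWeight p t j + binomTail p t (j + 1) := by
  unfold binomTail
  rw [binomExp_eq_sum (T := t + j + 1) (by omega), binomExp_eq_sum (T := t + j + 1) (by omega)]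
  rw [show binomWeight p t j =
    ∑ x ∈ Finset.range (t + j + 1), if x = j then binomWeight p t x else 0 by
      rw [Finset.sum_ite_eq', if_pos (by simp)]]
  rw [← Finset.sum_add_distrib]
  refine Finset.sum_congr rfl fun x _ => ?_
  rcases lt_trichotomy x j with h | h | h
  · simp [show ¬ j ≤ x by omega, show ¬ j + 1 ≤ x by omega, h.ne]
  · simp [h]
  · simp [show j ≤ x by omega, show j + 1 ≤ x by omega, h.ne']

theorem binomTail_succ_succ (j : ℕ) :
    binomTail p (t + 1) (j + 1) = p * binomTail p t j + (1 - p) * binomTail p t (j + 1) := by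
  simp [binomTail, binomExp]

theorem binomTail_le_one (hp : 0 ≤ p) (hp1 : p ≤ 1) (j : ℕ) : binomTail p t j ≤ 1 := by
  have h : binomTail p t j ≤ binomExp p t fun _ => 1 :=
    binomExp_mono_fun hp hp1 fun x => by split_ifs <;> norm_num
  rwa [binomExp_const] at h

/-- Markov's inequality. -/
theorem binomTail_le (hp : 0 ≤ p) (hp1 : p ≤ 1) {j : ℕ} (hj : 1 ≤ j) :
    binomTail p t j ≤ t * p / j := by
  have hj0 : (0 : ℝ) < j := by exact_mod_cast hj
  have h : binomTail p t j ≤ binomExp p t fun x => (1 / j : ℝ) * (x + 0) := by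
    refine binomExp_mono_fun hp hp1 fun x => ?_
    split_ifs with hx
    · have : (j : ℝ) ≤ x := by exact_mod_cast hx
      rw [add_zero, one_div, inv_mul_eq_div, le_div_iff₀ hj0]; linarith
    · positivity
  rw [binomExp_mul_left, binomExp_id_add] at h
  calc _ ≤ _ := h
    _ = _ := by field_simp; ring

/-- The probability that a uniformly chosen element of a set of size `c` is not among the `k`
smallest ones, or zero if `c < j`. -/
noncomputable def excess (k j c : ℕ) : ℝ := if j ≤ c then ((c - k : ℕ) : ℝ) / c else 0

/-- The ratio is `1 - k / c`, truncated at zero. Monotonicity is what permits passing to the extreme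
parameters. -/
theorem excess_mono {k j : ℕ} : Monotone (excess k j) := by
  intro a b hab
  unfold excess
  split_ifs with h1 h2
  · rcases Nat.eq_zero_or_pos a with ha | ha
    · subst ha; simp; positivity
    rw [div_le_div_iff₀ (by exact_mod_cast ha) (by exact_mod_cast (by omega : 0 < b))]
    norm_cast
    rcases le_total a k with hk | hk
    · rw [Nat.sub_eq_zero_of_le hk, zero_mul]; exact Nat.zero_le _
    · obtain ⟨d, rfl⟩ := Nat.exists_eq_add_of_le hk
      obtain ⟨e, rfl⟩ := Nat.exists_eq_add_of_le hab
      rw [show k + d - k = d by omega, show k + d + e - k = d + e by omega]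
      nlinarith [Nat.zero_le (e * k)]
  · omega
  · positivity
  · exact le_rfl

theorem excess_shift_mono {k j : ℕ} : Monotone fun x => excess k j (x + 1) :=
  fun _ _ h => excess_mono (by omega)

/-- The weights of `t + 1` trials are those of `t` trials, shifted and reweighted. -/
theorem binomExp_inv_succ {j : ℕ} (hp : p ≠ 0) :
    binomExp p t (fun x => 1 / ((x : ℝ) + 1) * if j ≤ x then 1 else 0) =
      1 / ((t + 1) * p) * binomTail p (t + 1) (j + 1) := by
  rw [binomTail, binomExp_eq_sum (Nat.lt_succ_self t), binomExp_eq_sum (T := t + 2) (by omega),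
    Finset.sum_range_succ' _ (t + 1), if_neg (Nat.not_succ_le_zero j), mul_zero, add_zero,
    Finset.mul_sum]
  refine Finset.sum_congr rfl fun x _ => ?_
  have h2 := succ_mul_binomWeight_succ (p := p) (t := t) x
  have h3 : (x : ℝ) + 1 ≠ 0 := by positivity
  have h4 : (t : ℝ) + 1 ≠ 0 := by positivity
  rw [show binomWeight p t x = ((x : ℝ) + 1) * binomWeight p (t + 1) (x + 1) / ((t + 1) * p) by
    rw [h2]; field_simp]
  simp only [Nat.add_le_add_iff_right]
  split_ifs
  · field_simp
  · ring

/-- Evaluation of the expected excess as a difference of tails. -/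
theorem binomExp_excess {k j : ℕ} (hkj : k < j + 1) (hp : p ≠ 0) :
    binomExp p t (fun x => excess k (j + 1) (x + 1)) =
      binomTail p t j - k / ((t + 1) * p) * binomTail p (t + 1) (j + 1) := by
  have h1 : (fun x => excess k (j + 1) (x + 1)) = fun x : ℕ => (if j ≤ x then (1 : ℝ) else 0) +
      (-k : ℝ) * (1 / ((x : ℝ) + 1) * if j ≤ x then 1 else 0) := by
    funext x
    unfold excess
    by_cases hx : j ≤ x
    · have : (x : ℝ) + 1 ≠ 0 := by positivity
      rw [if_pos (by omega), if_pos hx, Nat.cast_sub (by omega)]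
      push_cast
      field_simp
      ring
    · rw [if_neg (by omega), if_neg hx]; ring
  rw [h1, binomExp_add, binomExp_mul_left, binomExp_inv_succ hp, ← binomTail]
  ring

end Binomial

/-! ### Stirling estimates at mean `k` -/

section Numerics

/-- Stirling's bound on the probability that a binomial random variable equals its mean. -/
theorem binomWeight_mean_le {k A : ℕ} (hk : 1 ≤ k) (hA : 1 ≤ A) :
    binomWeight (k / (k + A : ℕ)) (k + A) k ≤ √((k + A) / (2 * Real.pi * k * A)) := by
  have hk0 : (0 : ℝ) < k := by exact_mod_cast hk
  have hA0 : (0 : ℝ) < A := by exact_mod_cast hA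
  have hpi := Real.pi_pos
  have hf : ∀ j : ℕ, 1 ≤ j → (j.factorial : ℝ) =
      Stirling.stirlingSeq j * (√(2 * j) * (j / Real.exp 1) ^ j) := by
    intro j hj
    have hj0 : (0 : ℝ) < j := by exact_mod_cast hj
    rw [Stirling.stirlingSeq, div_mul_cancel₀]
    positivity
  -- The sequence decreases to `√π`: the factor for `k + A` is cancelled against the one for `k`,
  -- and the one for `A` is bounded below by its limit.
  have hS1 : Stirling.stirlingSeq (k + A) ≤ Stirling.stirlingSeq k := by
    have := Stirling.stirlingSeq'_antitone (show k - 1 ≤ k + A - 1 by omega)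
    simp only [Function.comp, Nat.succ_eq_add_one] at this
    rwa [Nat.sub_add_cancel hk, Nat.sub_add_cancel (by omega)] at this
  have hSA := Stirling.sqrt_pi_le_stirlingSeq (n := A) (by omega)
  have hSk := Stirling.sqrt_pi_le_stirlingSeq (n := k) (by omega)
  have hpi' : 0 < √Real.pi := Real.sqrt_pos.2 hpi
  have hSk0 : 0 < Stirling.stirlingSeq k := hpi'.trans_le hSk
  have hSA0 : 0 < Stirling.stirlingSeq A := hpi'.trans_le hSA
  have he := Real.exp_pos 1
  have hw : binomWeight (k / (k + A : ℕ)) (k + A) k =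
      Stirling.stirlingSeq (k + A) / Stirling.stirlingSeq k *
        (√(2 * (k + A)) / (√(2 * k) * √(2 * A))) / Stirling.stirlingSeq A := by
    have h1k : (1 : ℝ) - k / (k + A : ℕ) = A / (k + A : ℕ) := by
      push_cast; field_simp; ring
    rw [binomWeight, h1k, Nat.add_sub_cancel_left, Nat.cast_add_choose, hf k hk, hf A hA,
      hf (k + A) (by omega)]
    have hs1 : 0 < √(2 * (k : ℝ)) := Real.sqrt_pos.2 (by positivity)
    have hs2 : 0 < √(2 * (A : ℝ)) := Real.sqrt_pos.2 (by positivity)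
    simp only [div_pow, pow_add]
    push_cast
    have hkA : (0 : ℝ) < k + A := by positivity
    field_simp
  have hrhs : √(((k : ℝ) + A) / (2 * Real.pi * k * A)) =
      √(2 * (k + A)) / (√(2 * k) * √(2 * A)) / √Real.pi := by
    rw [← Real.sqrt_mul (by positivity), ← Real.sqrt_div (by positivity),
      ← Real.sqrt_div (by positivity)]
    congr 1
    field_simp
  rw [hw, hrhs]
  have h1 : Stirling.stirlingSeq (k + A) / Stirling.stirlingSeq k ≤ 1 := by
    rw [div_le_one hSk0]; exact hS1
  have h2 : (0 : ℝ) ≤ √(2 * (k + A)) / (√(2 * k) * √(2 * A)) := by positivity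
  exact div_le_div₀ h2 (by nlinarith) hpi' hSA

theorem binomExp_excess_eq_zero {p : ℝ} {t k j : ℕ} (h : t < j) :
    binomExp p t (fun x => excess k (j + 1) (x + 1)) = 0 := by
  rw [binomExp_eq_sum (Nat.lt_succ_self t)]
  refine Finset.sum_eq_zero fun x hx => ?_
  have := Finset.mem_range.1 hx
  rw [excess, if_neg (by omega), mul_zero]

/-- The expected excess with mean `k`, for a key that takes part in the process. -/
theorem binomExp_excess_mean {k A : ℕ} (hk : 1 ≤ k) (hA : 1 ≤ A) :
    binomExp (k / (k + A : ℕ)) (k + A - 1) (fun x => excess k (k + 1) (x + 1)) =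
      (1 - k / (k + A : ℕ)) * binomWeight (k / (k + A : ℕ)) (k + A) k := by
  obtain ⟨A, rfl⟩ := Nat.exists_eq_add_of_le' hA
  have hk0 : (0 : ℝ) < k := by exact_mod_cast hk
  have hp : (k : ℝ) / (k + (A + 1) : ℕ) ≠ 0 := by positivity
  have hpn : (((k + A : ℕ) : ℝ) + 1) * ((k : ℝ) / (k + (A + 1) : ℕ)) = k := by
    push_cast; field_simp; ring
  -- Since the mean is `k`, omitting one trial does not change the weight at `k`.
  have hw : binomWeight ((k : ℝ) / (k + (A + 1) : ℕ)) (k + A) k =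
      binomWeight ((k : ℝ) / (k + (A + 1) : ℕ)) (k + (A + 1)) k := by
    have hc : ((k + A).choose k : ℝ) * (k + A + 1) = (k + (A + 1)).choose k * (A + 1) := by
      have := Nat.choose_mul_succ_eq (k + A) k
      rw [show k + A + 1 - k = A + 1 by omega] at this
      exact_mod_cast this
    unfold binomWeight
    rw [show k + A - k = A by omega, show k + (A + 1) - k = A + 1 by omega, pow_succ]
    have : (1 : ℝ) - k / (k + (A + 1) : ℕ) = (A + 1) / (k + A + 1) := by
      push_cast; field_simp; ring
    rw [this]
    have h0 : (k : ℝ) + A + 1 ≠ 0 := by positivity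
    field_simp
    linear_combination hc
  -- The coefficient of the second tail is `k / (n * p) = 1`, so the difference of tails collapses
  -- to a single weight.
  rw [show k + (A + 1) - 1 = k + A by omega, binomExp_excess (by omega) hp, hpn, div_self hk0.ne',
    one_mul, binomTail_succ_succ, binomTail_succ_right k, hw]
  ring

/-- Where the excess `(c - k) / c` is positive it is at least `1 / c`, and the expectation of `1 /
c` over this range is the tail divided by `k`. -/
theorem binomTail_mean_le {k A : ℕ} (hk : 1 ≤ k) (hA : 1 ≤ A) :
    binomTail (k / (k + A : ℕ)) (k + A) (k + 1) ≤
      k * ((1 - k / (k + A : ℕ)) * binomWeight (k / (k + A : ℕ)) (k + A) k) := by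
  rw [← binomExp_excess_mean hk hA]
  have hk0 : (0 : ℝ) < k := by exact_mod_cast hk
  have hp : (0 : ℝ) < k / (k + A : ℕ) := by positivity
  have hp1 : (k : ℝ) / (k + A : ℕ) ≤ 1 := by
    rw [div_le_one (by positivity)]; push_cast; linarith [(Nat.cast_nonneg A : (0 : ℝ) ≤ A)]
  have h := binomExp_inv_succ (t := k + A - 1) (j := k) hp.ne'
  have h1 : ((k + A - 1 : ℕ) : ℝ) + 1 = (k + A : ℕ) := by
    rw [Nat.cast_sub (by omega)]; push_cast; ring
  rw [h1, mul_div_cancel₀ _ (by positivity), Nat.sub_add_cancel (by omega)] at h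
  have h2 : binomTail (k / (k + A : ℕ)) (k + A) (k + 1) =
      k * (1 / k * binomTail (k / (k + A : ℕ)) (k + A) (k + 1)) := by field_simp
  rw [h2, ← h]
  refine mul_le_mul_of_nonneg_left (binomExp_mono_fun hp.le hp1 fun x => ?_) hk0.le
  unfold excess
  by_cases hx : k ≤ x
  · rw [if_pos hx, if_pos (by omega), mul_one]
    push_cast
    refine div_le_div_of_nonneg_right ?_ (by positivity)
    exact_mod_cast (by omega : 1 ≤ x + 1 - k)
  · simp [hx]

/-- The factor `√(A / (k + A))` is kept because the case of an extra key depends on it. -/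
theorem mean_weight_le {k A : ℕ} (hk : 1 ≤ k) (hA : 1 ≤ A) :
    (1 - k / (k + A : ℕ)) * binomWeight (k / (k + A : ℕ)) (k + A) k ≤
      √(A / (k + A)) * (1 / √(2 * Real.pi * k)) := by
  have hk0 : (0 : ℝ) < k := by exact_mod_cast hk
  have hA0 : (0 : ℝ) < A := by exact_mod_cast hA
  have hpi := Real.pi_pos
  have h1k : (1 : ℝ) - k / (k + A : ℕ) = A / (k + A) := by
    push_cast; field_simp; ring
  rw [h1k]
  have hq : (0 : ℝ) ≤ A / (k + A) := by positivity
  calc _ ≤ (A / (k + A) : ℝ) * √((k + A) / (2 * Real.pi * k * A)) :=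
        mul_le_mul_of_nonneg_left (binomWeight_mean_le hk hA) hq
    _ = √(A / (k + A)) * (1 / √(2 * Real.pi * k)) := by
        nth_rewrite 1 [← Real.mul_self_sqrt hq]
        rw [mul_assoc, ← Real.sqrt_mul hq, one_div, ← Real.sqrt_inv]
        congr 2
        field_simp

/-- The bound on the expected excess for a key that takes part in the process. -/
theorem binomExp_excess_le {n k : ℕ} (hk : 1 ≤ k) {p : ℝ} (hp : 0 ≤ p) (hpn : p ≤ k / n) {t : ℕ}
    (ht : t ≤ n - 1) :
    binomExp p t (fun x => excess k (k + 1) (x + 1)) ≤ 1 / √(2 * Real.pi * k) := by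
  rcases Nat.lt_or_ge t k with h | h
  · rw [binomExp_excess_eq_zero h]; positivity
  obtain ⟨A, rfl⟩ := Nat.exists_eq_add_of_le (show k ≤ n by omega)
  have hA : 1 ≤ A := by omega
  have hA0 : (0 : ℝ) < A := by exact_mod_cast hA
  have hp1 : (k : ℝ) / (k + A : ℕ) ≤ 1 := by
    rw [div_le_one (by positivity)]; push_cast; linarith
  calc _ ≤ _ := binomExp_mono_prob hp hpn hp1 excess_shift_mono
    _ ≤ _ := binomExp_mono_trials (by positivity) hp1 excess_shift_mono ht
    _ = _ := binomExp_excess_mean hk hA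
    _ ≤ _ := mean_weight_le hk hA
    _ ≤ 1 * (1 / √(2 * Real.pi * k)) := by
        refine mul_le_mul_of_nonneg_right ?_ (by positivity)
        refine Real.sqrt_le_iff.2 ⟨zero_le_one, ?_⟩
        rw [one_pow, div_le_one (by positivity)]
        linarith [(Nat.cast_nonneg k : (0 : ℝ) ≤ k)]
    _ = _ := one_mul _

/-- Cauchy–Schwarz for `(y, k / 2)` and `(k, z)`, whose norms are `A + k / 2` and `k + 1`, bounds
the second root uniformly in `A` and leaves room for `√(2πk)`. -/
theorem sqrt_two_pi_mul_add_le {k : ℕ} (hk : 10 ≤ k) (A : ℕ) :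
    √(2 * Real.pi * k) + √(A * (k + A)) * (k / (k + 1)) ≤ k + A + 1 := by
  have hk0 : (10 : ℝ) ≤ k := by exact_mod_cast hk
  have hA0 : (0 : ℝ) ≤ A := Nat.cast_nonneg A
  set y := √((A : ℝ) * (k + A)) with hy
  set z := √(2 * (k : ℝ) + 1) with hz
  have hy2 : y ^ 2 = A * (k + A) := Real.sq_sqrt (by positivity)
  have hz2 : z ^ 2 = 2 * k + 1 := Real.sq_sqrt (by positivity)
  -- Both `4.58 ≤ √21` and the fraction `5 / 11` below are the values at the smallest case `k = 10`.
  have hz1 : 4.58 ≤ z := Real.le_sqrt_of_sq_le (by nlinarith)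
  have h1 : y * k + z * (k / 2) ≤ (k + 1) * (A + k / 2) := by
    refine abs_le_of_sq_le_sq' ?_ (by positivity) |>.2
    have : ((k + 1) * (A + (k : ℝ) / 2)) ^ 2 = (y ^ 2 + (k / 2) ^ 2) * (k ^ 2 + z ^ 2) := by
      rw [hy2, hz2]; ring
    rw [this]
    nlinarith [sq_nonneg (y * z - k * (k / 2))]
  have h2 : √(2 * Real.pi * k) ≤ k / 2 + 1 + 4.58 * (5 / 11) := by
    refine Real.sqrt_le_iff.2 ⟨by positivity, ?_⟩
    have := Real.pi_lt_d2
    nlinarith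
  have h3 : y * (k / (k + 1)) + 4.58 * (5 / 11) ≤ A + k / 2 := by
    have h4 : (5 / 11 : ℝ) ≤ (k / 2) / (k + 1) := by
      rw [div_le_div_iff₀ (by norm_num) (by positivity)]; linarith
    have h5 : y * (k / (k + 1)) + z * ((k / 2) / (k + 1)) ≤ A + k / 2 := by
      have : y * (k / (k + 1)) + z * ((k / 2) / (k + 1)) = (y * k + z * (k / 2)) / (k + 1) := by
        field_simp
      rw [this, div_le_iff₀ (by positivity)]; linarith
    have h6 : 4.58 * (5 / 11 : ℝ) ≤ z * ((k / 2) / (k + 1)) := by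
      apply mul_le_mul hz1 h4 (by norm_num) (by positivity)
    linarith
  linarith

theorem sqrt_div_mul_le {k : ℕ} (hk1 : 1 ≤ k) (hk : k ≤ 9) (A : ℕ) :
    √((A : ℝ) / (k + A)) * (k * (k + A + k + 1)) ≤ (k + A + 1) * (k + 1) := by
  have hA0 : (0 : ℝ) ≤ A := Nat.cast_nonneg A
  have hk0 : (0 : ℝ) < k := by exact_mod_cast hk1
  refine abs_le_of_sq_le_sq' ?_ (by positivity) |>.2
  rw [mul_pow, Real.sq_sqrt (by positivity), div_mul_eq_mul_div, div_le_iff₀ (by positivity)]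
  generalize (A : ℝ) = a at hA0
  have h2 := mul_nonneg hA0 hA0
  have h3 := mul_nonneg hA0 h2
  -- After squaring, a cubic inequality in `a ≥ 0` remains for each `k`; the hints are squares
  -- weighted by `a`.
  interval_cases k <;> push_cast <;>
    nlinarith [mul_nonneg hA0 (sq_nonneg (a - 4)), mul_nonneg hA0 (sq_nonneg (a - 9))]

/-- The bound on the expected excess for a key that is added after `n` others. -/
theorem binomExp_excess_succ_le {n k : ℕ} (hk : 1 ≤ k) {p : ℝ} (hp : 0 ≤ p) (hpn : p ≤ k / n)
    {t : ℕ} (ht : t ≤ n) :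
    binomExp p t (fun x => excess k (k + 1 + 1) (x + 1)) ≤ 1 / √(2 * Real.pi * k) := by
  rcases Nat.lt_or_ge t (k + 1) with h | h
  · rw [binomExp_excess_eq_zero h]; positivity
  obtain ⟨A, rfl⟩ := Nat.exists_eq_add_of_le (show k ≤ n by omega)
  have hA : 1 ≤ A := by omega
  have hA0 : (0 : ℝ) < A := by exact_mod_cast hA
  have hk0 : (0 : ℝ) < k := by exact_mod_cast hk
  have hp1 : (k : ℝ) / (k + A : ℕ) ≤ 1 := by
    rw [div_le_one (by positivity)]; push_cast; linarith
  have hpp : (0 : ℝ) < k / (k + A : ℕ) := by positivity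
  refine (binomExp_mono_prob hp hpn hp1 excess_shift_mono).trans ?_
  refine (binomExp_mono_trials hpp.le hp1 excess_shift_mono ht).trans ?_
  have hT1 := binomTail_le_one (t := k + A) hpp.le hp1 (k + 1)
  have hT2 := binomTail_mean_le hk hA
  have hW := mean_weight_le hk hA
  have hw : binomWeight ((k : ℝ) / (k + A : ℕ)) (k + A) (k + 1) =
      k / (k + 1) * binomWeight ((k : ℝ) / (k + A : ℕ)) (k + A) k := by
    have hc : ((k + A).choose (k + 1) : ℝ) * (k + 1) = (k + A).choose k * A := by
      have := Nat.choose_succ_right_eq (k + A) k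
      rw [Nat.add_sub_cancel_left] at this
      exact_mod_cast this
    obtain ⟨B, rfl⟩ := Nat.exists_eq_add_of_le' hA
    unfold binomWeight
    rw [show k + (B + 1) - (k + 1) = B by omega, show k + (B + 1) - k = B + 1 by omega, pow_succ,
      pow_succ]
    have : (1 : ℝ) - k / (k + (B + 1) : ℕ) = (B + 1) / (k + B + 1) := by
      push_cast; field_simp; ring
    rw [this]
    push_cast at hc ⊢
    field_simp
    linear_combination (k + B + 1 : ℝ) * hc
  -- With `n = k + A` the coefficient of the second tail is `n / (n + 1)`. The tails no longer
  -- cancel, and one copy of `T` is left over.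
  have hmain : (k + A + 1) * binomExp ((k : ℝ) / (k + A : ℕ)) (k + A)
      (fun x => excess k (k + 1 + 1) (x + 1)) =
      binomTail ((k : ℝ) / (k + A : ℕ)) (k + A) (k + 1) + (k + A) * (k / (k + 1)) *
        ((1 - k / (k + A : ℕ)) * binomWeight ((k : ℝ) / (k + A : ℕ)) (k + A) k) := by
    rw [binomExp_excess (by omega) hpp.ne', binomTail_succ_succ,
      show binomTail ((k : ℝ) / (k + A : ℕ)) (k + A) (k + 1 + 1) =
        binomTail ((k : ℝ) / (k + A : ℕ)) (k + A) (k + 1) -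
          binomWeight ((k : ℝ) / (k + A : ℕ)) (k + A) (k + 1) by
        rw [binomTail_succ_right (k + 1)]; ring, hw]
    push_cast
    field_simp
    ring
  set W := (1 - (k : ℝ) / (k + A : ℕ)) * binomWeight ((k : ℝ) / (k + A : ℕ)) (k + A) k
  set T := binomTail ((k : ℝ) / (k + A : ℕ)) (k + A) (k + 1)
  set c := 1 / √(2 * Real.pi * k) with hc
  have hc0 : 0 < c := by have := Real.pi_pos; positivity
  have hkA : (0 : ℝ) < k + A + 1 := by positivity
  refine le_of_mul_le_mul_left ?_ hkA
  rw [hmain]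
  -- The leftover tail is bounded by `k * W` for small `k` and by `1` for large `k`.
  rcases Nat.lt_or_ge k 10 with h10 | h10
  · have h1 := sqrt_div_mul_le hk (by omega : k ≤ 9) A
    have h2 : T + (k + A) * (k / (k + 1)) * W ≤ (k * (k + A + k + 1)) / (k + 1) * W := by
      have : (k * (k + A + k + 1)) / (k + 1) * W = k * W + (k + A) * (k / (k + 1)) * W := by
        field_simp; ring
      rw [this]; linarith
    refine h2.trans ?_
    rw [div_mul_eq_mul_div, div_le_iff₀ (by positivity)]
    calc _ ≤ (k * (k + A + k + 1) : ℝ) * (√(A / (k + A)) * c) :=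
          mul_le_mul_of_nonneg_left hW (by positivity)
      _ = (√(A / (k + A)) * (k * (k + A + k + 1) : ℝ)) * c := by ring
      _ ≤ ((k + A + 1) * (k + 1)) * c := mul_le_mul_of_nonneg_right h1 hc0.le
      _ = _ := by ring
  · have h1 := sqrt_two_pi_mul_add_le h10 A
    have hsq : ((k : ℝ) + A) * √(A / (k + A)) = √(A * (k + A)) := by
      rw [← Real.sqrt_sq (by positivity : (0 : ℝ) ≤ k + A), ← Real.sqrt_mul (by positivity)]
      rw [Real.sqrt_sq (by positivity : (0 : ℝ) ≤ k + A)]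
      congr 1
      field_simp
    have h2 : (k + A) * (k / (k + 1)) * W ≤ √(A * (k + A)) * (k / (k + 1)) * c := by
      calc _ ≤ ((k : ℝ) + A) * (k / (k + 1)) * (√(A / (k + A)) * c) :=
            mul_le_mul_of_nonneg_left hW (by positivity)
        _ = _ := by rw [← hsq]; ring
    have h3 : √(2 * Real.pi * k) * c = 1 := by
      rw [hc, mul_one_div, div_self]
      have := Real.pi_pos
      positivity
    have h4 := mul_le_mul_of_nonneg_right h1 hc0.le
    rw [add_mul, h3] at h4
    linarith

end Numerics

/-! ### Uniform averages, displaced keys and concentration of the excess -/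

section FiniteAverages

open Finset
open scoped BigOperators

theorem expect_insertNth {V : Type*} [Fintype V] {t : ℕ} (i : Fin (t + 1))
    (G : (Fin (t + 1) → V) → ℝ) :
    𝔼 f, G f = 𝔼 v : V, 𝔼 g : Fin t → V, G (i.insertNth v g) := by
  rw [← expect_product', univ_product_univ]
  exact (Fintype.expect_equiv (Fin.insertNthEquiv (fun _ => V) i) _ _ fun _ => rfl).symm

/-- The variance with respect to the uniform distribution. -/
noncomputable def unifVar {β : Type*} [Fintype β] (F : β → ℝ) : ℝ := 𝔼 a, (F a - 𝔼 b, F b) ^ 2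

theorem expect_sq_sub {β : Type*} [Fintype β] [Nonempty β] (F : β → ℝ) (c : ℝ) :
    𝔼 a, (F a - c) ^ 2 = unifVar F + (𝔼 a, F a - c) ^ 2 := by
  unfold unifVar
  set M := 𝔼 a, F a with hM
  have h : ∀ a, (F a - c) ^ 2 = (F a - M) ^ 2 + ((2 * (M - c)) * (F a - M) + (M - c) ^ 2) := by
    intro a; ring
  simp only [h, expect_add_distrib, ← mul_expect, expect_sub_distrib, Fintype.expect_const, ← hM]
  ring

theorem unifVar_le {β : Type*} [Fintype β] [Nonempty β] (F : β → ℝ) (c : ℝ) :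
    unifVar F ≤ 𝔼 a, (F a - c) ^ 2 := by
  rw [expect_sq_sub]; nlinarith [sq_nonneg (𝔼 a, F a - c)]

theorem unifVar_nonneg {β : Type*} [Fintype β] (F : β → ℝ) : 0 ≤ unifVar F :=
  expect_nonneg fun _ _ => sq_nonneg _

theorem sq_expect_le {β : Type*} [Fintype β] [Nonempty β] (F : β → ℝ) :
    (𝔼 a, F a) ^ 2 ≤ 𝔼 a, F a ^ 2 := by
  have h := expect_sq_sub F 0
  simp only [sub_zero] at h
  rw [h]; linarith [unifVar_nonneg F]

/-- Convexity of the square: averaging does not increase the variance. -/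
theorem unifVar_expect_le {β γ : Type*} [Fintype β] [Fintype γ] [Nonempty γ]
    (F : γ → β → ℝ) : unifVar (fun b => 𝔼 c, F c b) ≤ 𝔼 c, unifVar (F c) := by
  have h : 𝔼 b, 𝔼 c, F c b = 𝔼 c, 𝔼 b, F c b := expect_comm _ _ _
  calc unifVar (fun b => 𝔼 c, F c b)
      = 𝔼 b, (𝔼 c, (F c b - 𝔼 b, F c b)) ^ 2 := by
        simp only [unifVar, expect_sub_distrib, h]
    _ ≤ 𝔼 b, 𝔼 c, (F c b - 𝔼 b, F c b) ^ 2 := expect_le_expect fun b _ => sq_expect_le _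
    _ = 𝔼 c, unifVar (F c) := expect_comm _ _ _

/-- The Efron–Stein inequality for independent uniform variables. -/
theorem efron_stein {V : Type*} [Fintype V] [Nonempty V] {t : ℕ} (F : (Fin t → V) → ℝ) :
    unifVar F ≤ ∑ i, 𝔼 f, unifVar fun u => F (Function.update f i u) := by
  induction t with
  | zero => simp [unifVar]
  | succ t ih =>
    -- The law of total variance, conditioning on all coordinates but the first.
    have h1 : unifVar F = (𝔼 g : Fin t → V, unifVar fun v => F (Fin.cons v g)) +
        unifVar fun g : Fin t → V => 𝔼 v, F (Fin.cons v g) := by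
      have hmean : 𝔼 f, F f = 𝔼 g : Fin t → V, 𝔼 v, F (Fin.cons v g) := by
        rw [expect_insertNth 0, expect_comm]; simp
      conv_lhs => rw [unifVar, expect_insertNth 0, expect_comm, hmean]
      simp only [Fin.insertNth_zero', expect_sq_sub, expect_add_distrib, sub_self]
      ring
    rw [h1, Fin.sum_univ_succ]
    refine add_le_add (le_of_eq ?_) ((ih _).trans (sum_le_sum fun i _ => ?_))
    · rw [expect_insertNth 0]
      simp [Fin.update_cons_zero]
    · rw [expect_insertNth 0, expect_comm]
      refine expect_le_expect fun g _ => ?_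
      refine (unifVar_expect_le _).trans (le_of_eq ?_)
      simp [Fin.cons_update]

variable {m s : ℕ}

/-- The number of keys in a bin. -/
def binCount {t : ℕ} (f : Fin t → Fin m × Fin s) (b : Fin m) : ℕ := #{j | (f j).1 = b}

theorem binCount_insertNth {t : ℕ} (i : Fin (t + 1)) (v : Fin m × Fin s)
    (g : Fin t → Fin m × Fin s) (b : Fin m) :
    binCount (i.insertNth v g : Fin (t + 1) → Fin m × Fin s) b =
      binCount g b + if v.1 = b then 1 else 0 := by
  simp only [binCount, card_filter]
  rw [Fin.sum_univ_succAbove _ i]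
  simp [add_comm]

/-- Each of the `c` keys of a bin contributes `(c - k) / c`, in total `c - k`. -/
theorem sum_excess_binCount {t : ℕ} (f : Fin t → Fin m × Fin s) (k j : ℕ) :
    ∑ i, excess k j (binCount f (f i).1) =
      ∑ b, if j ≤ binCount f b then ((binCount f b - k : ℕ) : ℝ) else 0 := by
  rw [← sum_fiberwise univ fun i => (f i).1]
  refine sum_congr rfl fun b _ => ?_
  rw [sum_congr rfl (g := fun _ => excess k j (binCount f b)) fun i hi => by
    rw [(mem_filter.1 hi).2], sum_const, nsmul_eq_mul]
  change (binCount f b : ℝ) * _ = _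
  unfold excess
  split_ifs
  · rcases Nat.eq_zero_or_pos (binCount f b) with h | h
    · simp [h]
    · have : (binCount f b : ℝ) ≠ 0 := by exact_mod_cast h.ne'
      field_simp
  · simp

/-- At most `#S - k` elements of `S` have `k` smaller ones. -/
theorem card_filter_le_card_smaller {ι κ : Type*} [LinearOrder κ] (S : Finset ι) (val : ι → κ)
    (k : ℕ) : #{i ∈ S | k ≤ #{j ∈ S | val j < val i}} ≤ #S - k := by
  classical
  rcases (S.filter fun i => k ≤ #{j ∈ S | val j < val i}).eq_empty_or_nonempty with h | h
  · rw [h]; simp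
  -- The `k` elements below the smallest member of the filtered set lie outside that set.
  obtain ⟨i, hi, hmin⟩ := exists_min_image _ val h
  have hdisj : Disjoint (S.filter fun i => k ≤ #{j ∈ S | val j < val i})
      (S.filter fun j => val j < val i) := by
    rw [disjoint_left]
    intro j hj hj'
    exact absurd (hmin j hj) (not_le.2 (mem_filter.1 hj').2)
  have h1 := card_le_card (union_subset (filter_subset (fun i => k ≤ #{j ∈ S | val j < val i}) S)
    (filter_subset (fun j => val j < val i) S))
  rw [card_union_of_disjoint hdisj] at h1
  have h2 := (mem_filter.1 hi).2
  omega

/-- The key `i` is not among the `k` smallest ones of its bin, which has at least `c` keys. -/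
def Displaced {t : ℕ} (k c : ℕ) (f : Fin t → Fin m × Fin s) (i : Fin t) : Prop :=
  k ≤ #{j | (f j).1 = (f i).1 ∧ (f j).2 < (f i).2} ∧ c ≤ binCount f (f i).1

instance {t : ℕ} (k c : ℕ) (f : Fin t → Fin m × Fin s) (i : Fin t) : Decidable (Displaced k c f i) :=
  inferInstanceAs (Decidable (_ ∧ _))

theorem sum_displaced_le {t : ℕ} (k c : ℕ) (f : Fin t → Fin m × Fin s) :
    ∑ i, (if Displaced k c f i then (1 : ℝ) else 0) ≤ ∑ i, excess k c (binCount f (f i).1) := by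
  rw [sum_excess_binCount, ← sum_fiberwise univ fun i => (f i).1]
  refine sum_le_sum fun b _ => ?_
  split_ifs with hc
  · rw [← sum_filter, sum_const, nsmul_one, Nat.cast_le, filter_filter]
    refine le_trans (card_le_card ?_)
      (card_filter_le_card_smaller (univ.filter fun i => (f i).1 = b) (fun i => (f i).2) k)
    intro i hi
    simp only [mem_filter, mem_univ, true_and, filter_filter] at hi ⊢
    obtain ⟨rfl, h2⟩ := hi
    exact ⟨rfl, h2.1⟩
  · refine (sum_eq_zero fun i hi => if_neg fun h => hc ?_).le
    rw [← (mem_filter.1 hi).2]; exact h.2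

theorem displaced_comp_perm {t : ℕ} (k c : ℕ) (f : Fin t → Fin m × Fin s) (e : Equiv.Perm (Fin t))
    (i : Fin t) : Displaced k c (f ∘ e) i ↔ Displaced k c f (e i) := by
  have h : ∀ P : Fin t → Prop, ∀ [DecidablePred P], #{j | P (e j)} = #{j | P j} := by
    intro P _
    rw [card_filter, card_filter]
    exact Equiv.sum_comp e fun j => if P j then 1 else 0
  unfold Displaced binCount
  simp only [Function.comp]
  rw [h fun j => (f j).1 = (f (e i)).1 ∧ (f j).2 < (f (e i)).2, h fun j => (f j).1 = (f (e i)).1]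

/-- The number of keys that do not fit into their bins. -/
noncomputable def totalExcess {t : ℕ} (k : ℕ) (f : Fin t → Fin m × Fin s) : ℝ :=
  ∑ b, ((binCount f b - k : ℕ) : ℝ)

theorem totalExcess_eq {t : ℕ} (k : ℕ) (f : Fin t → Fin m × Fin s) :
    totalExcess k f = ∑ i, excess k (k + 1) (binCount f (f i).1) := by
  rw [sum_excess_binCount]
  refine sum_congr rfl fun b _ => ?_
  split_ifs with h
  · rfl
  · simp [show binCount f b - k = 0 by omega]

theorem totalExcess_insertNth {t k : ℕ} (i : Fin (t + 1)) (v : Fin m × Fin s)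
    (g : Fin t → Fin m × Fin s) :
    totalExcess k (i.insertNth v g : Fin (t + 1) → Fin m × Fin s) =
      totalExcess k g + if k ≤ binCount g v.1 then 1 else 0 := by
  unfold totalExcess
  rw [show (if k ≤ binCount g v.1 then (1 : ℝ) else 0) =
    ∑ b, if v.1 = b then (if k ≤ binCount g b then (1 : ℝ) else 0) else 0 by simp,
    ← sum_add_distrib]
  refine sum_congr rfl fun b _ => ?_
  rw [binCount_insertNth]
  split_ifs with h1 h2
  · rw [show binCount g b + 1 - k = binCount g b - k + 1 by omega]; push_cast; ring
  · rw [show binCount g b + 1 - k = binCount g b - k by omega]; simp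
  · simp

variable [NeZero m] [NeZero s]

theorem expect_ite_fst (b : Fin m) (x y : ℝ) :
    𝔼 v : Fin m × Fin s, (if v.1 = b then x else y) = 1 / m * x + (1 - 1 / m) * y := by
  have hm : (m : ℝ) ≠ 0 := by exact_mod_cast NeZero.ne m
  rw [← univ_product_univ, expect_product]
  have h : ∀ a : Fin m, (if a = b then x else y) = y + if a = b then x - y else 0 := by
    intro a; split_ifs <;> ring
  simp only [Fintype.expect_const, h, expect_add_distrib]
  rw [Fintype.expect_eq_sum_div_card]
  simp
  ring

/-- The number of keys in a fixed bin has a binomial distribution. -/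
theorem expect_binCount (t : ℕ) (b : Fin m) (g : ℕ → ℝ) :
    𝔼 f : Fin t → Fin m × Fin s, g (binCount f b) = binomExp (1 / m) t g := by
  induction t generalizing g with
  | zero => simp [binCount, binomExp]
  | succ t ih =>
    rw [expect_insertNth 0]
    simp only [binCount_insertNth]
    have h : ∀ v : Fin m × Fin s, (𝔼 f : Fin t → Fin m × Fin s,
        g (binCount f b + if v.1 = b then 1 else 0)) =
        if v.1 = b then binomExp (1 / m) t (fun x => g (x + 1)) else binomExp (1 / m) t g := by
      intro v
      split_ifs
      · exact ih fun x => g (x + 1)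
      · exact ih g
    rw [expect_congr rfl fun v _ => h v, expect_ite_fst]
    rfl

theorem expect_binCount_self {t : ℕ} (i : Fin (t + 1)) (g : ℕ → ℝ) :
    𝔼 f : Fin (t + 1) → Fin m × Fin s, g (binCount f (f i).1) =
      binomExp (1 / m) t fun x => g (x + 1) := by
  rw [expect_insertNth i]
  simp [binCount_insertNth, expect_binCount _ _ fun x => g (x + 1)]

/-- By symmetry, a displaced key is equally likely to be any of the keys. -/
theorem expect_displaced_le {t : ℕ} (k c : ℕ) (i : Fin (t + 1)) :
    𝔼 f : Fin (t + 1) → Fin m × Fin s, (if Displaced k c f i then (1 : ℝ) else 0) ≤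
      binomExp (1 / m) t fun x => excess k c (x + 1) := by
  have hsymm : ∀ j : Fin (t + 1),
      𝔼 f : Fin (t + 1) → Fin m × Fin s, (if Displaced k c f j then (1 : ℝ) else 0) =
      𝔼 f : Fin (t + 1) → Fin m × Fin s, (if Displaced k c f i then (1 : ℝ) else 0) := by
    intro j
    refine Fintype.expect_equiv (Equiv.arrowCongr (Equiv.swap i j) (Equiv.refl _)) _ _ fun f => ?_
    have h : (Equiv.arrowCongr (Equiv.swap i j) (Equiv.refl _)) f = f ∘ Equiv.swap i j := by
      ext x <;> simp [Equiv.arrowCongr]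
    rw [h]
    simp only [displaced_comp_perm, Equiv.swap_apply_left]
  have h1 : ((t : ℝ) + 1) * 𝔼 f : Fin (t + 1) → Fin m × Fin s,
      (if Displaced k c f i then (1 : ℝ) else 0) ≤
      (t + 1) * binomExp (1 / m) t fun x => excess k c (x + 1) := by
    calc _ = ∑ j : Fin (t + 1), 𝔼 f : Fin (t + 1) → Fin m × Fin s,
          (if Displaced k c f j then (1 : ℝ) else 0) := by
          rw [sum_congr rfl fun j _ => hsymm j]; simp
      _ = 𝔼 f : Fin (t + 1) → Fin m × Fin s, ∑ j, (if Displaced k c f j then (1 : ℝ) else 0) :=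
          (expect_sum_comm _ _ _).symm
      _ ≤ 𝔼 f : Fin (t + 1) → Fin m × Fin s, ∑ j, excess k c (binCount f (f j).1) :=
          expect_le_expect fun f _ => sum_displaced_le k c f
      _ = ∑ j : Fin (t + 1), 𝔼 f : Fin (t + 1) → Fin m × Fin s,
          excess k c (binCount f (f j).1) := expect_sum_comm _ _ _
      _ = _ := by
          rw [sum_congr rfl fun j _ => expect_binCount_self j (excess k c)]; simp
  exact le_of_mul_le_mul_left h1 (by positivity)

theorem expect_totalExcess (t k : ℕ) :
    𝔼 f : Fin (t + 1) → Fin m × Fin s, totalExcess k f =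
      (t + 1) * binomExp (1 / m) t fun x => excess k (k + 1) (x + 1) := by
  simp only [totalExcess_eq]
  rw [expect_sum_comm, sum_congr rfl fun j _ => expect_binCount_self j (excess k (k + 1))]
  simp

/-- Comparing with the excess without key `i`, resampling that key adds zero or one, and adds one
only if its bin already holds `k` of the others. -/
theorem unifVar_totalExcess_le (t k : ℕ) :
    unifVar (fun f : Fin (t + 1) → Fin m × Fin s => totalExcess k f) ≤
      (t + 1) * binomTail (1 / m) t k := by
  refine (efron_stein _).trans ?_
  have h : ∀ i : Fin (t + 1), (𝔼 f : Fin (t + 1) → Fin m × Fin s,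
      unifVar fun u => totalExcess k (Function.update f i u)) ≤ binomTail (1 / m) t k := by
    intro i
    rw [expect_insertNth i]
    have h1 : ∀ (v : Fin m × Fin s) (g : Fin t → Fin m × Fin s), (unifVar fun u => totalExcess k
        (Function.update (i.insertNth v g : Fin (t + 1) → Fin m × Fin s) i u)) ≤
        𝔼 u : Fin m × Fin s, if k ≤ binCount g u.1 then 1 else 0 := by
      intro v g
      refine (unifVar_le _ (totalExcess k g)).trans (expect_le_expect fun u _ => ?_)
      rw [Fin.update_insertNth, totalExcess_insertNth, add_sub_cancel_left]
      split_ifs <;> norm_num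
    refine (expect_le_expect fun v _ => expect_le_expect fun g _ => h1 v g).trans ?_
    rw [Fintype.expect_const, expect_comm]
    refine le_of_eq ?_
    rw [expect_congr rfl fun u _ => expect_binCount t u.1 fun x => if k ≤ x then 1 else 0]
    exact Fintype.expect_const _
  refine (sum_le_sum fun i _ => h i).trans (le_of_eq ?_)
  simp

/-- The concentration of the total excess. -/
theorem expect_totalExcess_gt_le {n k t : ℕ} (hk : 1 ≤ k) (ht : t ≤ n)
    (hmn : (1 : ℝ) / m ≤ k / n) :
    𝔼 f : Fin t → Fin m × Fin s,
      (if totalExcess k f ≤ 1.1 / √(2 * Real.pi * k) * t then (0 : ℝ) else 1) ≤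
        failureBound n k := by
  have hpi := Real.pi_pos
  have hk0 : (0 : ℝ) < k := by exact_mod_cast hk
  rcases t with _ | t
  · rw [expect_eq_zero]
    · unfold failureBound; positivity
    · intro f _
      rw [if_pos]
      simp [totalExcess, binCount]
  have hn0 : (0 : ℝ) < n := by exact_mod_cast (by omega : 0 < n)
  have hm0 : (0 : ℝ) < m := by exact_mod_cast Nat.pos_of_ne_zero (NeZero.ne m)
  have hm1 : (1 : ℝ) / m ≤ 1 := by
    rw [div_le_one hm0]; exact_mod_cast Nat.pos_of_ne_zero (NeZero.ne m)
  set c := 1 / √(2 * Real.pi * k) with hc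
  have hc0 : 0 < c := by positivity
  have hc2 : c ^ 2 = 1 / (2 * Real.pi * k) := by
    rw [hc, div_pow, Real.sq_sqrt (by positivity), one_pow]
  set M := 𝔼 f : Fin (t + 1) → Fin m × Fin s, totalExcess k f with hM
  have hMle : M ≤ (t + 1) * c := by
    rw [hM, expect_totalExcess]
    exact mul_le_mul_of_nonneg_left
      (binomExp_excess_le hk (by positivity) hmn (by omega)) (by positivity)
  have hvar : unifVar (fun f : Fin (t + 1) → Fin m × Fin s => totalExcess k f) ≤
      (t + 1) ^ 2 / n := by
    refine (unifVar_totalExcess_le t k).trans ?_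
    -- Markov's inequality: the mean is `t / m`, at most `t * k / n`.
    have h1 : binomTail (1 / m) t k ≤ (t + 1) / n := by
      refine (binomTail_le (by positivity) hm1 hk).trans ?_
      rw [div_le_div_iff₀ hk0 hn0]
      rw [div_le_div_iff₀ hm0 hn0] at hmn
      have h2 : (t : ℝ) * (1 / m) * n ≤ t * k := by
        rw [mul_one_div, div_mul_eq_mul_div, div_le_iff₀ hm0]
        nlinarith [(Nat.cast_nonneg t : (0 : ℝ) ≤ t)]
      linarith
    calc _ ≤ ((t : ℝ) + 1) * ((t + 1) / n) := mul_le_mul_of_nonneg_left h1 (by positivity)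
      _ = _ := by ring
  -- Chebyshev's inequality: since `M ≤ (t + 1) * c`, exceeding `1.1` times this bound forces a
  -- deviation greater than `d`.
  set d := 0.1 * ((t + 1) * c) with hd
  have hd0 : 0 < d := by positivity
  calc _ ≤ 𝔼 f : Fin (t + 1) → Fin m × Fin s, 1 / d ^ 2 * (totalExcess k f - M) ^ 2 := by
        refine expect_le_expect fun f _ => ?_
        split_ifs with h
        · positivity
        · rw [one_div, inv_mul_eq_div, one_le_div (by positivity)]
          have h1 : 1.1 / √(2 * Real.pi * k) * ((t + 1 : ℕ) : ℝ) = 1.1 * ((t + 1) * c) := by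
            rw [hc]; push_cast; ring
          rw [h1, not_le] at h
          exact pow_le_pow_left₀ hd0.le (by rw [hd]; linarith) 2
    _ = 1 / d ^ 2 * unifVar (fun f : Fin (t + 1) → Fin m × Fin s => totalExcess k f) := by
        rw [← mul_expect]; rfl
    _ ≤ 1 / d ^ 2 * ((t + 1) ^ 2 / n) := mul_le_mul_of_nonneg_left hvar (by positivity)
    _ = 2 * Real.pi * k / (0.1 ^ 2 * n) := by
        rw [hd, mul_pow, mul_pow, hc2]; field_simp
    -- The factor `0.99` of the stated bound is pure slack here.
    _ ≤ failureBound n k := by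
        unfold failureBound
        refine div_le_div_of_nonneg_left (by positivity) (by positivity) ?_
        nlinarith

end FiniteAverages

/-! ### From probabilities to finite averages -/

section RandomFunction

open Finset
open scoped BigOperators

variable {U Ω Θ : Type*} [MeasurableSpace Ω] [MeasurableSpace Θ] {m s : ℕ}
  {μ : Measure Ω} {ν : Measure Θ}
  {FP : U → Ω → Fin m × Fin s}

theorem IsRandomFunction.measureReal_forall_eq (hFP : IsRandomFunction FP μ) {t : ℕ}
    {e : Fin t → U} (he : Function.Injective e) (f : Fin t → Fin m × Fin s) :
    μ.real {ω | ∀ i, FP (e i) ω = f i} = 1 / Fintype.card (Fin t → Fin m × Fin s) := by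
  have h1 : {ω | ∀ i, FP (e i) ω = f i} = ⋂ i ∈ (univ : Finset (Fin t)), FP (e i) ⁻¹' {f i} := by
    ext ω; simp
  have h2 := (hFP.indep.precomp he).measure_inter_preimage_eq_mul univ
    (sets := fun i => {f i}) fun i _ => measurableSet_singleton _
  rw [h1, Measure.real, h2, ENNReal.toReal_prod]
  have h3 : ∀ i : Fin t, (μ (FP (e i) ⁻¹' {f i})).toReal = 1 / ((m : ℝ) * s) :=
    fun i => hFP.uniform (e i) (f i)
  simp [h3, mul_pow, mul_comm]

theorem IsRandomFunction.measurableSet_forall_eq (hFP : IsRandomFunction FP μ) {t : ℕ}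
    (e : Fin t → U) (f : Fin t → Fin m × Fin s) :
    MeasurableSet {ω | ∀ i, FP (e i) ω = f i} := by
  have h1 : {ω | ∀ i, FP (e i) ω = f i} = ⋂ i, FP (e i) ⁻¹' {f i} := by
    ext ω; simp
  rw [h1]
  exact MeasurableSet.iInter fun i => hFP.measurable _ (measurableSet_singleton _)

open scoped Classical in
/-- Probabilities of events that concern finitely many keys are finite averages. -/
theorem IsRandomFunction.measureReal_eq_expect [IsProbabilityMeasure μ]
    (hFP : IsRandomFunction FP μ) {t : ℕ} {e : Fin t → U} (he : Function.Injective e) (P : (Fin t → Fin m × Fin s) → Prop) :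
    μ.real {ω | P fun i => FP (e i) ω} = 𝔼 f, if P f then (1 : ℝ) else 0 := by
  have h1 : {ω | P fun i => FP (e i) ω} =
      ⋃ f ∈ univ.filter P, {ω | ∀ i, FP (e i) ω = f i} := by
    ext ω
    simp only [Set.mem_ofPred_eq, mem_filter, mem_univ, true_and, Set.mem_iUnion, exists_prop]
    constructor
    · intro h; exact ⟨_, h, fun i => rfl⟩
    · rintro ⟨f, hf, h⟩
      rwa [show (fun i => FP (e i) ω) = f from funext h]
  rw [h1, measureReal_biUnion_finset]
  · rw [sum_congr rfl fun f _ => hFP.measureReal_forall_eq he f, Fintype.expect_eq_sum_div_card,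
      ← sum_filter, sum_const, sum_const]
    simp [div_eq_mul_inv]
  · intro f _ g _ hfg
    rw [Function.onFun, Set.disjoint_left]
    intro ω h2 h3
    exact hfg (funext fun i => (h2 i).symm.trans (h3 i))
  · intro f _; exact hFP.measurableSet_forall_eq e f

/-- Fubini over the finitely many fingerprint patterns. The event is covered by rectangles, so
subadditivity suffices and `E` need not be measurable. -/
theorem IsRandomFunction.measureReal_prod_le_expect [IsProbabilityMeasure μ]
    [IsProbabilityMeasure ν] (hFP : IsRandomFunction FP μ) {t : ℕ}
    {e : Fin t → U} (he : Function.Injective e) (E : (Fin t → Fin m × Fin s) → Set Θ) :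
    (μ.prod ν).real {ω | ω.2 ∈ E fun i => FP (e i) ω.1} ≤ 𝔼 f, ν.real (E f) := by
  have h1 : {ω : Ω × Θ | ω.2 ∈ E fun i => FP (e i) ω.1} ⊆
      ⋃ f ∈ (univ : Finset (Fin t → Fin m × Fin s)), {ω | ∀ i, FP (e i) ω = f i} ×ˢ E f := by
    intro ω hω
    simp only [Set.mem_iUnion, mem_univ, exists_prop, true_and]
    exact ⟨_, fun i => rfl, hω⟩
  refine (measureReal_mono h1 (measure_ne_top _ _)).trans
    ((measureReal_biUnion_finset_le _ _).trans (le_of_eq ?_))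
  rw [Fintype.expect_eq_sum_div_card, sum_div]
  refine sum_congr rfl fun f _ => ?_
  rw [measureReal_prod_prod, hFP.measureReal_forall_eq he]
  ring

theorem measureReal_prod_fst [IsProbabilityMeasure ν] (P : Ω → Prop) :
    (μ.prod ν).real {ω | P ω.1} = μ.real {ω | P ω} := by
  have h : {ω : Ω × Θ | P ω.1} = {ω | P ω} ×ˢ Set.univ := by ext; simp
  rw [h, measureReal_prod_prod, probReal_univ, mul_one]

open scoped Classical in
theorem IsRandomFunction.one_sub_le_measureReal_prod [IsProbabilityMeasure μ]
    [IsProbabilityMeasure ν] (hFP : IsRandomFunction FP μ) {t : ℕ}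
    [NeZero m] [NeZero s] {e : Fin t → U} (he : Function.Injective e)
    (P : (Fin t → Fin m × Fin s) → Prop) {δ : ℝ} (hδ : 𝔼 f, (if P f then (1 : ℝ) else 0) ≤ δ)
    {E : Set (Ω × Θ)} (hE : ∀ ω : Ω × Θ, ¬ P (fun i => FP (e i) ω.1) → ω ∈ E) :
    1 - δ ≤ (μ.prod ν).real E := by
  have h1 : (μ.prod ν).real {ω | ¬ P fun i => FP (e i) ω.1} ≤ (μ.prod ν).real E :=
    measureReal_mono hE
  refine le_trans ?_ h1
  rw [measureReal_prod_fst fun ω => ¬ P fun i => FP (e i) ω,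
    hFP.measureReal_eq_expect he fun f => ¬ P f]
  calc 1 - δ ≤ 1 - 𝔼 f, (if P f then (1 : ℝ) else 0) := by linarith
    _ = 𝔼 f, (1 - if P f then (1 : ℝ) else 0) := by
        rw [expect_sub_distrib, Fintype.expect_const]
    _ ≤ _ := expect_le_expect fun f _ => by split_ifs <;> simp_all

theorem card_filter_eq_countP {β : Type*} {t : ℕ} (f : Fin t → β) (p : β → Prop)
    [DecidablePred p] : #{j | p (f j)} = (List.ofFn f).countP fun v => p v := by
  rw [← Multiset.coe_countP, ← Fin.univ_val_map f, Multiset.countP_map]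
  rfl

theorem map_eq_ofFn {β : Type*} (L : List U) (h : U → β) :
    L.map h = List.ofFn fun i => h (L.get i) :=
  (List.ofFn_getElem_eq_map L h).symm

variable [NeZero s]

/-- The number of insertions that reach the spare. -/
theorem run_snd_eq_totalExcess {N b k : ℕ} {ε : ℝ} (hk : 1 ≤ k)
    (F : IncrementalFilter (Fin m × Fin s) N ε b ν) (θ : Θ) (h : U → Fin m × Fin s)
    (σ : List (Op U)) :
    ((run k F θ h σ).2 : ℝ) = totalExcess k fun i => h ((insertedKeys σ).get i) := by
  rw [run_eq_model, length_forwarded hk, totalExcess, Nat.cast_sum]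
  refine sum_congr rfl fun b _ => ?_
  rw [binCount, card_filter_eq_countP _ fun v : Fin m × Fin s => v.1 = b, map_eq_ofFn]

/-- Key `i` is itself among the insertions, so an overflow means at least `k + 1` keys in its bin.
-/
theorem displaced_of_forwarded {k t : ℕ} (hk : 1 ≤ k) (f : Fin t → Fin m × Fin s) (i : Fin t)
    (h : ((model k (List.ofFn f)).1 (f i).1).overflowed = true ∧
      ((model k (List.ofFn f)).1 (f i).1).fps.sup < (f i).2) :
    Displaced k (k + 1) f i := by
  obtain ⟨h1, h2⟩ := le_countP_of_forwarded hk _ _ h.1 h.2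
  constructor
  · rwa [card_filter_eq_countP f fun v => v.1 = (f i).1 ∧ v.2 < (f i).2]
  · rw [binCount, card_filter_eq_countP f fun v => v.1 = (f i).1]
    exact h1

/-- The extra key is placed in front of the inserted ones. Its bin overflows without it, so together
with it there are at least `k + 2` keys. -/
theorem displaced_zero_of_forwarded {k t : ℕ} (hk : 1 ≤ k) (f : Fin (t + 1) → Fin m × Fin s)
    (h : ((model k (List.ofFn (Fin.tail f))).1 (f 0).1).overflowed = true ∧
      ((model k (List.ofFn (Fin.tail f))).1 (f 0).1).fps.sup < (f 0).2) :
    Displaced k (k + 1 + 1) f 0 := by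
  obtain ⟨h1, h2⟩ := le_countP_of_forwarded hk _ _ h.1 h.2
  have hf : List.ofFn f = f 0 :: List.ofFn (Fin.tail f) := List.ofFn_succ
  constructor
  · rw [card_filter_eq_countP f fun v => v.1 = (f 0).1 ∧ v.2 < (f 0).2, hf, List.countP_cons]
    exact h2.trans (Nat.le_add_right _ _)
  · rw [binCount, card_filter_eq_countP f fun v => v.1 = (f 0).1, hf, List.countP_cons]
    simpa using h1

theorem queryFP_snd_eq {N b : ℕ} {ε : ℝ} (F : IncrementalFilter (Fin m × Fin s) N ε b ν) (θ : Θ)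
    (st : State m s b) (v : Fin m × Fin s)
    (h : ¬ ((st.bins v.1).overflowed = true ∧ (st.bins v.1).fps.sup < v.2)) :
    (queryFP F θ st v).2 = [Loc.bin v.1] := by
  simp only [queryFP, if_neg h]

variable [NeZero m]

theorem expect_eq_zeroth {t : ℕ} (j : Fin t) :
    𝔼 f : Fin (t + 1) → Fin m × Fin s, (if f j.succ = f 0 then (1 : ℝ) else 0) =
      1 / ((m : ℝ) * s) := by
  rw [expect_insertNth 0, expect_comm]
  simp only [Fin.insertNth_zero', Fin.cons_succ, Fin.cons_zero]
  have h : ∀ w : Fin m × Fin s, (𝔼 v : Fin m × Fin s, if w = v then (1 : ℝ) else 0) =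
      1 / ((m : ℝ) * s) := by
    intro w
    rw [Fintype.expect_eq_sum_div_card]
    simp
  rw [expect_congr rfl fun g _ => h (g j), Fintype.expect_const]

/-- The set of random choices of the spare for which the query `f 0` is answered with "Yes" after
the insertion of the other values of `f`, provided that the filter does not fail. -/
def acceptSet {N b t : ℕ} {ε : ℝ} (k : ℕ) (F : IncrementalFilter (Fin m × Fin s) N ε b ν)
    (f : Fin (t + 1) → Fin m × Fin s) : Set Θ :=
  {θ | ¬ N < (model k (List.ofFn (Fin.tail f))).2.length ∧
    (queryFP F θ ⟨(model k (List.ofFn (Fin.tail f))).1,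
      (model k (List.ofFn (Fin.tail f))).2.foldl (F.insert θ) (F.init θ)⟩ (f 0)).1 = true}

/-- A coincidence of fingerprints already makes the sum at least one. Without one the bin answers
"No", and only a displaced key leads to the spare, which has never received the fingerprint. -/
theorem measureReal_acceptSet_le [IsProbabilityMeasure ν] {N b t k : ℕ} {ε : ℝ} (hk : 1 ≤ k)
    (F : IncrementalFilter (Fin m × Fin s) N ε b ν) (f : Fin (t + 1) → Fin m × Fin s) :
    ν.real (acceptSet k F f) ≤ ∑ j : Fin t, (if f j.succ = f 0 then (1 : ℝ) else 0) +
      ε * if Displaced k (k + 1 + 1) f 0 then 1 else 0 := by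
  -- The empty spare already forces a nonnegative error rate.
  have hε : 0 ≤ ε := measureReal_nonneg.trans
    (F.false_positive [] (Nat.zero_le _) (0, 0) (by simp))
  have hs0 : 0 ≤ ∑ j : Fin t, (if f j.succ = f 0 then (1 : ℝ) else 0) :=
    sum_nonneg fun j _ => by split_ifs <;> norm_num
  have hd0 : 0 ≤ ε * if Displaced k (k + 1 + 1) f 0 then (1 : ℝ) else 0 := by
    split_ifs <;> simp [hε]
  by_cases hcoll : ∃ j : Fin t, f j.succ = f 0
  · obtain ⟨j, hj⟩ := hcoll
    have h1 : (1 : ℝ) ≤ ∑ j : Fin t, (if f j.succ = f 0 then (1 : ℝ) else 0) := by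
      refine le_trans (by rw [if_pos hj]) (single_le_sum (f := fun j : Fin t =>
        if f j.succ = f 0 then (1 : ℝ) else 0) (fun j _ => by split_ifs <;> norm_num) (mem_univ j))
    exact measureReal_le_one.trans (by linarith)
  · have hnot : f 0 ∉ List.ofFn (Fin.tail f) := by
      rw [List.mem_ofFn]
      rintro ⟨j, hj⟩
      exact hcoll ⟨j, hj⟩
    by_cases hfw : ((model k (List.ofFn (Fin.tail f))).1 (f 0).1).overflowed = true ∧
        ((model k (List.ofFn (Fin.tail f))).1 (f 0).1).fps.sup < (f 0).2
    · have hdisp := displaced_zero_of_forwarded hk f hfw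
      rw [if_pos hdisp, mul_one]
      by_cases hN : (model k (List.ofFn (Fin.tail f))).2.length ≤ N
      · have hsub : acceptSet k F f ⊆ {θ | F.query θ
            ((model k (List.ofFn (Fin.tail f))).2.foldl (F.insert θ) (F.init θ)) (f 0) = true} := by
          rintro θ ⟨_, hθ⟩
          simp only [queryFP, if_pos hfw] at hθ
          exact hθ
        have h1 := F.false_positive _ hN (f 0)
          fun hmem => hnot ((model_inv hk _).mem_of_forwarded _ hmem)
        linarith [measureReal_mono hsub (μ := ν)]
      · have hempty : acceptSet k F f = ∅ := by
          refine Set.eq_empty_of_forall_notMem fun θ hθ => hN (not_lt.1 hθ.1)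
        rw [hempty, measureReal_empty]; linarith
    · have hempty : acceptSet k F f = ∅ := by
        refine Set.eq_empty_of_forall_notMem fun θ hθ => hnot ?_
        have := hθ.2
        simp only [queryFP, if_neg hfw, decide_eq_true_eq] at this
        exact mem_of_mem_bin hk _ _ this
      rw [hempty, measureReal_empty]; linarith

end RandomFunction

/-! ### The probabilistic claims -/

section Main

open Finset
open scoped BigOperators

variable {U Ω Θ : Type*} [MeasurableSpace Ω] [MeasurableSpace Θ] {m s : ℕ} [NeZero m] [NeZero s]
  {μ : Measure Ω} [IsProbabilityMeasure μ] {ν : Measure Θ} [IsProbabilityMeasure ν]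
  {FP : U → Ω → Fin m × Fin s} {n k N b : ℕ} {ε : ℝ}

/-- The query is treated as a zeroth key, independent of the inserted ones; the two summands of
`measureReal_acceptSet_le` are then averaged. -/
theorem IsRandomFunction.falsePositive_le (hFP : IsRandomFunction FP μ) (hk : 1 ≤ k)
    (hmn : (1 : ℝ) / m ≤ k / n) (F : IncrementalFilter (Fin m × Fin s) N ε b ν)
    {σ : List (Op U)} (hσ : Admissible n σ) {y : U} (hy : y ∉ insertedKeys σ) :
    (μ.prod ν).real {ω | ¬ Failed k F ω.2 (fun x => FP x ω.1) σ ∧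
      (queryFP F ω.2 (run k F ω.2 (fun x => FP x ω.1) σ).1 (FP y ω.1)).1 = true} ≤
        n * (1 / ((m : ℝ) * s)) + 1 / √(2 * Real.pi * k) * ε := by
  have hε : 0 ≤ ε := measureReal_nonneg.trans
    (F.false_positive [] (Nat.zero_le _) (0, 0) (by simp))
  have he : Function.Injective (y :: insertedKeys σ).get :=
    List.nodup_iff_injective_get.1 (List.nodup_cons.2 ⟨hy, hσ.1⟩)
  have hset : {ω : Ω × Θ | ¬ Failed k F ω.2 (fun x => FP x ω.1) σ ∧
      (queryFP F ω.2 (run k F ω.2 (fun x => FP x ω.1) σ).1 (FP y ω.1)).1 = true} =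
      {ω | ω.2 ∈ acceptSet (t := (insertedKeys σ).length) k F
        fun i => FP ((y :: insertedKeys σ).get i) ω.1} := by
    ext ω
    simp only [Set.mem_ofPred_eq, Failed, run_eq_model, map_eq_ofFn]
    rfl
  rw [hset]
  refine (hFP.measureReal_prod_le_expect he _).trans ?_
  refine (expect_le_expect fun f _ => measureReal_acceptSet_le
    (t := (insertedKeys σ).length) hk F f).trans ?_
  rw [expect_add_distrib, ← mul_expect, expect_sum_comm,
    sum_congr rfl fun j _ => expect_eq_zeroth (t := (insertedKeys σ).length) j]
  refine add_le_add ?_ ?_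
  · rw [sum_const, nsmul_eq_mul]
    refine mul_le_mul_of_nonneg_right ?_ (by positivity)
    simpa using hσ.2
  · rw [mul_comm]
    refine mul_le_mul_of_nonneg_right ?_ hε
    exact (expect_displaced_le (t := (insertedKeys σ).length) k (k + 1 + 1) 0).trans
      (binomExp_excess_succ_le hk (by positivity) hmn hσ.2)

theorem IsRandomFunction.le_measureReal_query (hFP : IsRandomFunction FP μ) (hk : 1 ≤ k)
    (hmn : (1 : ℝ) / m ≤ k / n) (F : IncrementalFilter (Fin m × Fin s) N ε b ν)
    {σ : List (Op U)} (hσ : Admissible n σ) (y : U) :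
    1 - 1 / √(2 * Real.pi * k) ≤ (μ.prod ν).real {ω | (queryFP F ω.2
      (run k F ω.2 (fun x => FP x ω.1) σ).1 (FP y ω.1)).2 = [Loc.bin (FP y ω.1).1]} := by
  classical
  obtain ⟨hnd, hlen⟩ := hσ
  -- An inserted key is one of at most `n` keys; any other is an additional key, for which the
  -- sharper numerical estimate is needed.
  by_cases hy : y ∈ insertedKeys σ
  · obtain ⟨i, hi⟩ := List.mem_iff_get.1 hy
    have he := List.nodup_iff_injective_get.1 hnd
    refine hFP.one_sub_le_measureReal_prod he (fun f => Displaced k (k + 1) f i) ?_ ?_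
    · clear hi he
      revert i hlen
      generalize (insertedKeys σ).length = t
      intro hlen i
      obtain _ | t := t
      · exact i.elim0
      · refine le_trans (le_of_eq ?_) ((expect_displaced_le (m := m) (s := s) k (k + 1) i).trans
          (binomExp_excess_le hk (by positivity) hmn (by omega)))
        exact expect_congr rfl fun f _ => by congr
    · intro ω hω
      refine queryFP_snd_eq F _ _ _ fun h => hω ?_
      rw [run_eq_model, map_eq_ofFn] at h
      refine displaced_of_forwarded hk _ i ?_
      rw [hi]
      exact h
  · have he : Function.Injective (y :: insertedKeys σ).get :=
      List.nodup_iff_injective_get.1 (List.nodup_cons.2 ⟨hy, hnd⟩)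
    refine hFP.one_sub_le_measureReal_prod he (fun f => Displaced k (k + 1 + 1) f
      (0 : Fin ((insertedKeys σ).length + 1))) ?_ ?_
    · refine le_trans (le_of_eq ?_)
        ((expect_displaced_le (m := m) (s := s) (t := (insertedKeys σ).length) k (k + 1 + 1) 0).trans
          (binomExp_excess_succ_le hk (by positivity) hmn hlen))
      exact expect_congr rfl fun f _ => by congr
    · intro ω hω
      refine queryFP_snd_eq F _ _ _ fun h => hω ?_
      rw [run_eq_model, map_eq_ofFn] at h
      exact displaced_zero_of_forwarded (t := (insertedKeys σ).length) hk _ h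

theorem IsRandomFunction.le_measureReal_insertions (hFP : IsRandomFunction FP μ) (hk : 1 ≤ k)
    (hmn : (1 : ℝ) / m ≤ k / n) (F : IncrementalFilter (Fin m × Fin s) N ε b ν)
    {σ : List (Op U)} (hσ : Admissible n σ) :
    1 - failureBound n k ≤ (μ.prod ν).real {ω | ((run k F ω.2 (fun x => FP x ω.1) σ).2 : ℝ) ≤
      1.1 / √(2 * Real.pi * k) * (insertedKeys σ).length} := by
  classical
  refine hFP.one_sub_le_measureReal_prod (List.nodup_iff_injective_get.1 hσ.1)
    (fun f => ¬ totalExcess k f ≤ 1.1 / √(2 * Real.pi * k) * (insertedKeys σ).length) ?_ ?_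
  · refine le_trans (le_of_eq ?_) (expect_totalExcess_gt_le (m := m) (s := s) hk hσ.2 hmn)
    refine expect_congr rfl fun f _ => ?_
    split_ifs <;> simp_all
  · intro ω hω
    rw [not_not] at hω
    simp only [Set.mem_ofPred_eq]
    rwa [run_snd_eq_totalExcess hk]

end Main

end PrefixFilter

theorem theorem1 {U Ω Θ : Type*} [MeasurableSpace Ω] [MeasurableSpace Θ]
    (μ : MeasureTheory.Measure Ω) [MeasureTheory.IsProbabilityMeasure μ]
    (ν : MeasureTheory.Measure Θ) [MeasureTheory.IsProbabilityMeasure ν]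
    (n k m s : ℕ) [NeZero s] (hn : 1 ≤ n) (hk : 1 ≤ k)
    (α : ℝ) (hα : 0 < α) (hα1 : α ≤ 1) (hm : (m : ℝ) = n / (α * k))
    (ε' : ℝ) (S : ℝ → ℝ → ℕ)
    (F : PrefixFilter.IncrementalFilter (Fin m × Fin s) ⌊PrefixFilter.spareSize n k⌋₊ ε'
      (S (PrefixFilter.spareSize n k) ε') ν)
    (FP : U → Ω → Fin m × Fin s) (hFP : PrefixFilter.IsRandomFunction FP μ) :
    -- false positive rate
    (∀ σ : List (PrefixFilter.Op U), PrefixFilter.Admissible n σ →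
      ∀ y, y ∉ PrefixFilter.insertedKeys σ →
        (μ.prod ν).real {ω | ¬ PrefixFilter.Failed k F ω.2 (fun x => FP x ω.1) σ ∧
          (PrefixFilter.queryFP F ω.2
            (PrefixFilter.run k F ω.2 (fun x => FP x ω.1) σ).1 (FP y ω.1)).1 = true} ≤
        α * k / s + 1 / √(2 * Real.pi * k) * ε') ∧
    -- failure probability
    (∀ σ : List (PrefixFilter.Op U), PrefixFilter.Admissible n σ →
      1 - PrefixFilter.failureBound n k ≤
        (μ.prod ν).real {ω | ¬ PrefixFilter.Failed k F ω.2 (fun x => FP x ω.1) σ}) ∧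
    -- cache lines accessed by a query (positive or negative) that is issued after `σ`
    (∀ σ : List (PrefixFilter.Op U), PrefixFilter.Admissible n σ → ∀ y,
      1 - 1 / √(2 * Real.pi * k) ≤
        (μ.prod ν).real {ω | (PrefixFilter.queryFP F ω.2
          (PrefixFilter.run k F ω.2 (fun x => FP x ω.1) σ).1 (FP y ω.1)).2 =
            [PrefixFilter.Loc.bin (FP y ω.1).1]}) ∧
    -- insertions that access the spare
    (∀ σ : List (PrefixFilter.Op U), PrefixFilter.Admissible n σ →
      1 - PrefixFilter.failureBound n k ≤
        (μ.prod ν).real {ω | ((PrefixFilter.run k F ω.2 (fun x => FP x ω.1) σ).2 : ℝ) ≤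
          1.1 / √(2 * Real.pi * k) * (PrefixFilter.insertedKeys σ).length}) ∧
    -- memory
    (∀ R : ℕ, s = k * 2 ^ R →
      (∀ st ∈ PrefixFilter.reachableStates U k F,
        ((PrefixFilter.memory k R st).length : ℝ) =
          1 / α * n * (Real.logb 2 ((s : ℝ) / k) + 2) + S (PrefixFilter.spareSize n k) ε') ∧
      Set.InjOn (PrefixFilter.memory k R) (PrefixFilter.reachableStates U k F)) := by
  have hn0 : (0 : ℝ) < n := by exact_mod_cast hn
  have hk0 : (0 : ℝ) < k := by exact_mod_cast hk
  have hm0 : (0 : ℝ) < m := by rw [hm]; positivity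
  have : NeZero m := ⟨by rintro rfl; simp at hm0⟩
  have hs0 : (s : ℝ) ≠ 0 := by exact_mod_cast NeZero.ne s
  -- This is where `α ≤ 1` enters: the expected load of a bin is at most `k`.
  have hmn : (1 : ℝ) / m ≤ k / n := by
    rw [hm, one_div_div]
    exact div_le_div_of_nonneg_right (by nlinarith) hn0.le
  refine ⟨fun σ hσ y hy => ?_, fun σ hσ => ?_, fun σ hσ y => hFP.le_measureReal_query hk hmn F hσ y,
    fun σ hσ => hFP.le_measureReal_insertions hk hmn F hσ, fun R hR => ⟨fun st hst => ?_, ?_⟩⟩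
  · refine (hFP.falsePositive_le hk hmn F hσ hy).trans (le_of_eq ?_)
    congr 1
    rw [hm]
    field_simp
  · refine (hFP.le_measureReal_insertions hk hmn F hσ).trans
      (MeasureTheory.measureReal_mono fun ω hω hfail => ?_)
    simp only [Set.mem_ofPred_eq] at hω
    -- An integer above `⌊n'⌋` exceeds `n'`, so a failure contradicts the bound on the forwarded
    -- insertions.
    have hgt := (Nat.floor_lt (by unfold PrefixFilter.spareSize; positivity)).1 hfail
    have hsize : PrefixFilter.spareSize n k = 1.1 * (n / √(2 * Real.pi * k)) := rfl
    have hlen : ((PrefixFilter.insertedKeys σ).length : ℝ) ≤ n := by exact_mod_cast hσ.2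
    have h1 := mul_le_mul_of_nonneg_left hlen
      (by positivity : (0 : ℝ) ≤ 1.1 / √(2 * Real.pi * k))
    have h2 : 1.1 / √(2 * Real.pi * k) * n = 1.1 * (n / √(2 * Real.pi * k)) := by ring
    linarith
  · rw [PrefixFilter.length_memory hk hR (PrefixFilter.valid_of_mem_reachableStates hk hst)]
    have hlog : Real.logb 2 ((s : ℝ) / k) = R := by
      rw [hR]
      push_cast
      rw [mul_div_cancel_left₀ _ hk0.ne', Real.logb_pow, Real.logb_self_eq_one one_lt_two, mul_one]
    rw [hlog]
    push_cast
    rw [hm]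
    field_simp
  · intro st hst st' hst' h
    exact PrefixFilter.memory_inj hk hR (PrefixFilter.valid_of_mem_reachableStates hk hst)
      (PrefixFilter.valid_of_mem_reachableStates hk hst') h
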